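/- Rings are associative and need not have an identity. Let $R$ be a semiprime ring (no nonzero nilpotent two-sided ideals), $G$ a finite subgroup of $\mathrm{Aut}(R)$ and $R^G=\{r\in R\mid g(r)=r \text{ for all } g\in G\}$. For a ring $A$ and $n\ge 1$ put $\mathrm{tor}_n(A)=\{a\in A\mid n^ia=0\text{ for some } i\ge 1\}$; $A$ is $n$-torsion free if $\mathrm{tor}_n(A)=0$. Let $\mathcal B(R,G)$ be the (possibly empty) set of primes $p$ with $p\mid |G|$ and $\mathrm{tor}_p(R)\ne 0$. Suppose that for every $p\in\mathcal B(R,G)$: (1) $G$ has a normal $p$-complement, i.e. a normal subgroup of order $m$, where $|G|=p^sm$ and $p\nmid m$; and (2) $R^G$ is $|G|$-torsion free. For a ring $A$ let $\mathcal C_A$ be the set of its regular elements (elements that are neither left nor right zero-divisors), and let $Q_l(A)=\mathcal C_A^{-1}A$ and $Q_r(A)=A\,\mathcal C_A^{-1}$ be its classical left and right quotient rings, when they exist. A ring $A$ has finite left uniform dimension if it contains no infinite direct sum of nonzero left ideals; its left uniform dimension $\mathrm{udim}(A)$ is the supremum of the numbers $k$ such that $A$ contains a direct sum of $k$ nonzero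 left ideals. $A$ is left Goldie if it has finite left uniform dimension and satisfies the ascending chain condition on left annihilators of nonempty subsets. The right-hand notions are defined symmetrically. Then: 1. $R$ is left (resp. right) Goldie if and only if $R^G$ is. In this case $\mathcal C_{R^G}\subseteq\mathcal C_R$; $Q_l(R)$ (resp. $Q_r(R)$) exists and $Q_l(R)=\mathcal C_{R^G}^{-1}R$ (resp. $Q_r(R)=R\,\mathcal C_{R^G}^{-1}$); and the action of $G$ extends uniquely to an action by ring automorphisms on $Q_l(R)$ (resp. $Q_r(R)$), with $Q_l(R)^G=Q_l(R^G)$ (resp. $Q_r(R)^G=Q_r(R^G)$). 2. Let $\mathrm{udim}$ be either the left or the right uniform dimension. Then $\mathrm{udim}(R)<\infty$ if and only if $\mathrm{udim}(R^G)<\infty$, and in this case $$\mathrm{udim}(R^G)\le \mathrm{udim}(R)\le |G|\cdot\mathrm{udim}(R^G)<\infty .$$ -/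

import Mathlib

universe u v

namespace InvRing

/-! Rings are associative and need not have an identity element (`NonUnitalRing`). -/

section Ideals

variable {R : Type u} [NonUnitalRing R]

/-- An additive subgroup that is a left ideal. -/
def IsLeftIdeal (I : AddSubgroup R) : Prop := ∀ r x : R, x ∈ I → r * x ∈ I

/-- An additive subgroup that is a right ideal. -/
def IsRightIdeal (I : AddSubgroup R) : Prop := ∀ r x : R, x ∈ I → x * r ∈ I

variable (R)

/-- A semiprime ring: the only two-sided ideal of square zero is `0`. (Equivalently there is no
nonzero nilpotent ideal: if `I ^ k = 0` with `k ≥ 2` minimal, then `I ^ (k - 1)` is nonzero of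
square zero.) -/
def IsSemiprimeRing : Prop :=
  ∀ I : AddSubgroup R, IsLeftIdeal I → IsRightIdeal I →
    (∀ x ∈ I, ∀ y ∈ I, x * y = 0) → I = ⊥

/-- The set of regular elements (non-zero-divisors on both sides). -/
def regularElements : Set R := {c | IsRegular c}

/-- The `n`-torsion ideal, as a set. -/
def torsionSet (n : ℕ) : Set R := {r | ∃ i : ℕ, 1 ≤ i ∧ n ^ i • r = 0}

/-- `R` is `n`-torsion free. -/
def IsTorsionFreeRing (n : ℕ) : Prop := torsionSet R n = {0}

end Ideals

section Goldie

variable {R : Type u} [NonUnitalRing R]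

/-- A direct sum of nonzero members of the class `P` of additive subgroups (in use, `P` is the
class of left ideals or that of right ideals). -/
def IsDirectFamily {ι : Type*} (P : AddSubgroup R → Prop) (I : ι → AddSubgroup R) : Prop :=
  (∀ i, P (I i) ∧ I i ≠ ⊥) ∧ iSupIndep I

/-- There is no infinite direct sum of nonzero members of `P`. -/
def HasFiniteUDim (P : AddSubgroup R → Prop) : Prop :=
  ¬ ∃ I : ℕ → AddSubgroup R, IsDirectFamily P I

/-- The supremum of the lengths of the finite direct sums of nonzero members of `P`. -/
noncomputable def uDim (P : AddSubgroup R → Prop) : ℕ∞ :=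
  ⨆ n ∈ {n : ℕ | ∃ I : Fin n → AddSubgroup R, IsDirectFamily P I}, (n : ℕ∞)

/-- The left annihilator of a subset. -/
def leftAnn (X : Set R) : Set R := {r | ∀ x ∈ X, r * x = 0}

/-- The right annihilator of a subset. -/
def rightAnn (X : Set R) : Set R := {r | ∀ x ∈ X, x * r = 0}

variable (R)

/-- `R` has finite left uniform dimension. -/
def HasFiniteLeftUDim : Prop := HasFiniteUDim (R := R) IsLeftIdeal

/-- `R` has finite right uniform dimension. -/
def HasFiniteRightUDim : Prop := HasFiniteUDim (R := R) IsRightIdeal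

/-- The left uniform dimension. -/
noncomputable def leftUDim : ℕ∞ := uDim (R := R) IsLeftIdeal

/-- The right uniform dimension. -/
noncomputable def rightUDim : ℕ∞ := uDim (R := R) IsRightIdeal

/-- A left Goldie ring: finite left uniform dimension and the ascending chain condition for left
annihilators of nonempty subsets. -/
def IsLeftGoldie : Prop :=
  HasFiniteLeftUDim R ∧
    ∀ X : ℕ → Set R, (∀ n, (X n).Nonempty) → Monotone (fun n => leftAnn (X n)) →
      ∃ N, ∀ n, N ≤ n → leftAnn (X n) = leftAnn (X N)

/-- A right Goldie ring: finite right uniform dimension and the ascending chain condition for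
right annihilators of nonempty subsets. -/
def IsRightGoldie : Prop :=
  HasFiniteRightUDim R ∧
    ∀ X : ℕ → Set R, (∀ n, (X n).Nonempty) → Monotone (fun n => rightAnn (X n)) →
      ∃ N, ∀ n, N ≤ n → rightAnn (X n) = rightAnn (X N)

end Goldie

section Fractions

variable {R : Type u} [NonUnitalRing R] {Q : Type v} [Ring Q]

/-- `f : R → Q` makes `Q` the left ring of fractions `S⁻¹R`: the elements of `S` become units,
every element of `Q` has the form `(f s)⁻¹ (f r)` with `s ∈ S` and `r ∈ R`, and the kernel of `f`
consists of the elements that some `s ∈ S` annihilates from the left. -/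
structure IsLeftFractionRing (S : Set R) (f : R →ₙ+* Q) : Prop where
  isUnit_map : ∀ s ∈ S, IsUnit (f s)
  exists_fraction : ∀ q : Q, ∃ s ∈ S, ∃ r : R, f s * q = f r
  map_eq_zero_iff : ∀ r : R, f r = 0 ↔ ∃ s ∈ S, s * r = 0

/-- `f : R → Q` makes `Q` the right ring of fractions `RS⁻¹`: the elements of `S` become units,
every element of `Q` has the form `(f r) (f s)⁻¹` with `s ∈ S` and `r ∈ R`, and the kernel of `f`
consists of the elements that some `s ∈ S` annihilates from the right. -/
structure IsRightFractionRing (S : Set R) (f : R →ₙ+* Q) : Prop where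
  isUnit_map : ∀ s ∈ S, IsUnit (f s)
  exists_fraction : ∀ q : Q, ∃ s ∈ S, ∃ r : R, q * f s = f r
  map_eq_zero_iff : ∀ r : R, f r = 0 ↔ ∃ s ∈ S, r * s = 0

/-- `f : R → Q` makes `Q` the classical left quotient ring of `R`. -/
def IsLeftQuotientRing (f : R →ₙ+* Q) : Prop := IsLeftFractionRing (regularElements R) f

/-- `f : R → Q` makes `Q` the classical right quotient ring of `R`. -/
def IsRightQuotientRing (f : R →ₙ+* Q) : Prop := IsRightFractionRing (regularElements R) f

end Fractions

section Invariants

variable {R : Type u} [NonUnitalRing R] (G : Subgroup (RingAut R))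

/-- The ring `R^G` of `G`-invariants. -/
def invariants : NonUnitalSubring R where
  carrier := {r | ∀ g ∈ G, g r = r}
  zero_mem' := fun g _ => map_zero g
  add_mem' := fun {a b} ha hb g hg => by rw [map_add, ha g hg, hb g hg]
  neg_mem' := fun {a} ha g hg => by rw [map_neg, ha g hg]
  mul_mem' := fun {a b} ha hb g hg => by rw [map_mul, ha g hg, hb g hg]

/-- The set of regular elements of `R^G`, as a subset of `R`. -/
def regularInvariants : Set R :=
  (fun c : invariants G => (c : R)) '' regularElements (invariants G)

/-- The set of bad primes. -/
def badPrimes : Set ℕ := {p | p.Prime ∧ p ∣ Nat.card G ∧ torsionSet R p ≠ {0}}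

/-- The finite group `H` has a `p`-normal complement: a normal subgroup of order `m`, where
`|H| = p ^ s * m` with `m` not divisible by `p`. -/
def HasNormalPComplement (H : Type*) [Group H] (p : ℕ) : Prop :=
  ∃ N : Subgroup H, N.Normal ∧ ¬ p ∣ Nat.card N ∧ ∃ s : ℕ, Nat.card H = p ^ s * Nat.card N

variable {G} {Q : Type v} [Ring Q]

/-- The action `ρ` of `G` on `Q` extends the action of `G` on `R` along `f : R → Q`. -/
def ExtendsAction (f : R →ₙ+* Q) (ρ : G →* RingAut Q) : Prop :=
  ∀ (g : G) (r : R), ρ g (f r) = f ((g : RingAut R) r)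

/-- The ring `Q^G` of invariants of an action `ρ` of `G` on `Q`. -/
def fixedRing (ρ : G →* RingAut Q) : Subring Q where
  carrier := {q | ∀ g, ρ g q = q}
  zero_mem' := fun g => map_zero (ρ g)
  one_mem' := fun g => map_one (ρ g)
  add_mem' := fun {a b} ha hb g => by rw [map_add, ha g, hb g]
  neg_mem' := fun {a} ha g => by rw [map_neg, ha g]
  mul_mem' := fun {a b} ha hb g => by rw [map_mul, ha g, hb g]

/-- The restriction `R^G → Q^G` of `f : R → Q`. -/
def fixedMap (f : R →ₙ+* Q) (ρ : G →* RingAut Q) (h : ExtendsAction f ρ) :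
    invariants G →ₙ+* fixedRing ρ where
  toFun := fun r => ⟨f (r : R), fun g => by rw [h g r, r.2 g g.2]⟩
  map_zero' := Subtype.ext (map_zero f)
  map_add' := fun a b => Subtype.ext (map_add f (a : R) (b : R))
  map_mul' := fun a b => Subtype.ext (map_mul f (a : R) (b : R))

end Invariants

end InvRing

open InvRing

/-! The hypotheses on bad primes serve only to show that `R` has no `|G|`-torsion
(`smul_card_eq_zero`). If `R` had `p`-torsion with `p ∣ |G|`, averaging over the normal
`p`-complement `N`, of order prime to `p`, would give a nonzero `N`-fixed element of order `p`. Its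
`G`-orbit spans a finite `p`-group on which `N` acts trivially, a Sylow `p`-subgroup has a nonzero
fixed point there, and `N` together with the Sylow subgroup generates `G`. This contradicts
torsion-freeness of `R^G`.

Everything else rests on the Bergman–Isaacs theorem `eq_bot_of_mul_trace_eq_zero`: a `G`-invariant
left ideal `J` without `|G|`-torsion and with `J * trace J = 0` vanishes. The annihilator of `J` in
the skew group ring is shown to be an essential right `R`-submodule by averaging over an essential
complement, in the style of Maschke. Semiprimeness then forces `J = 0`. Consequently a nonzero
invariant left ideal meets `R^G` nontrivially.

Uniform dimension. Since the trace maps `R * I` into `I`, direct sums of left ideals of `R^G` extend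
to `R`, which gives the lower bound. For the upper bound, take a left ideal `x` maximal among those
containing no nonzero invariant left ideal. A direct sum in `R` that misses `x` produces one of the
same length in `R^G`. The conjugates of `x` intersect in zero, and these bounds add up under
intersection, hence the factor `|G|`.

Goldie property. A semiprime left Goldie ring is left nonsingular, and a left nonsingular ring of
finite left uniform dimension is left Goldie. The left singular ideal of `R` is invariant and meets
`R^G` inside the singular ideal of `R^G`, so nonsingularity passes up. The chain condition passes
down directly.

Quotient rings. For regular `c`, the largest invariant left ideal inside `R * c` is essential and
meets `R^G` in an essential left ideal, so by Goldie's theorem some multiple of `c` is a regular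
invariant. All denominators can thus be taken in `R^G`. The right-hand statements follow by passing
to opposite rings. -/

namespace InvRing

/-! ### Direct sums, essential subgroups and dimension bounds -/

section DirectSums

variable {M : Type*} [AddCommGroup M]

/-- A class of additive subgroups closed under binary intersections and arbitrary sums. -/
structure IsSumClosed (P : AddSubgroup M → Prop) : Prop where
  inf : ∀ {A B}, P A → P B → P (A ⊓ B)
  sSup : ∀ {s : Set (AddSubgroup M)}, (∀ A ∈ s, P A) → P (sSup s)

namespace IsSumClosed

variable {P : AddSubgroup M → Prop} (hP : IsSumClosed P)

include hP

theorem bot : P ⊥ := by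
  have := hP.sSup (s := ∅) (by simp)
  rwa [sSup_empty] at this

theorem sup {A B : AddSubgroup M} (hA : P A) (hB : P B) : P (A ⊔ B) := by
  rw [← sSup_pair]
  exact hP.sSup (by rintro C (rfl | rfl) <;> assumption)

theorem iSup {ι : Sort*} {A : ι → AddSubgroup M} (h : ∀ i, P (A i)) : P (⨆ i, A i) :=
  hP.sSup (by rintro _ ⟨i, rfl⟩; exact h i)

theorem finset_sup {ι : Type*} {A : ι → AddSubgroup M} (s : Finset ι) (h : ∀ i ∈ s, P (A i)) :
    P (s.sup A) := by
  rw [Finset.sup_eq_sSup_image]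
  exact hP.sSup (by rintro _ ⟨i, hi, rfl⟩; exact h i hi)

end IsSumClosed

/-- `E` meets every nonzero member of `P`. -/
def IsEssential (P : AddSubgroup M → Prop) (E : AddSubgroup M) : Prop :=
  ∀ X, P X → Disjoint X E → X = ⊥

theorem IsEssential.mono {P : AddSubgroup M → Prop} {E F : AddSubgroup M}
    (hE : IsEssential P E) (h : E ≤ F) : IsEssential P F :=
  fun X hX hd => hE X hX (hd.mono_right h)

theorem IsEssential.inf {P : AddSubgroup M → Prop} (hP : IsSumClosed P) {E F : AddSubgroup M}
    (hE : IsEssential P E) (hF : IsEssential P F) (hPE : P E) : IsEssential P (E ⊓ F) := by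
  intro X hX hd
  refine hE X hX (disjoint_iff.2 (hF _ (hP.inf hX hPE) ?_))
  rw [disjoint_iff, inf_assoc]
  exact hd.eq_bot

theorem IsEssential.iInf {P : AddSubgroup M → Prop} (hP : IsSumClosed P) {ι : Type*}
    {E : ι → AddSubgroup M} (hE : ∀ i, IsEssential P (E i)) (hPE : ∀ i, P (E i)) (s : Finset ι) :
    IsEssential P (s.inf E) := by
  classical
  induction s using Finset.induction_on with
  | empty => exact fun X _ hd => by simpa using hd
  | insert i s _ ih =>
    rw [Finset.inf_insert]
    exact (hE i).inf hP ih (hPE i)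

/-- Every member of `P` has a complement in `P` up to essential extension. -/
theorem exists_essential_complement {P : AddSubgroup M → Prop} (hP : IsSumClosed P)
    (N : AddSubgroup M) : ∃ L, P L ∧ Disjoint L N ∧ IsEssential P (N ⊔ L) := by
  obtain ⟨L, hL⟩ := zorn_le₀ {L : AddSubgroup M | P L ∧ Disjoint L N} (by
    intro c hc hchain
    refine ⟨sSup c, ⟨hP.sSup fun A hA => (hc hA).1, ?_⟩, fun z hz => le_sSup hz⟩
    rcases c.eq_empty_or_nonempty with rfl | hne
    · simp
    rw [AddSubgroup.disjoint_def]
    intro x hx hxN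
    obtain ⟨A, hA, hxA⟩ := (AddSubgroup.mem_sSup_of_directedOn hne hchain.directedOn).1 hx
    exact AddSubgroup.disjoint_def.1 (hc hA).2 hxA hxN)
  refine ⟨L, hL.1.1, hL.1.2, fun X hX hd => ?_⟩
  have h1 : Disjoint (X ⊔ L) N := by
    have := hL.1.2.symm.disjoint_sup_right_of_disjoint_sup_left hd.symm
    rw [sup_comm]; exact this.symm
  have h2 : X ≤ L := le_sup_left.trans (hL.2 ⟨hP.sup hX hL.1.1, h1⟩ le_sup_right)
  exact disjoint_self.1 (hd.mono_right (h2.trans le_sup_right))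

/-- Every direct sum of nonzero members of `P` that is disjoint from `y` has at most `b`
summands. -/
def DirectBound (P : AddSubgroup M → Prop) (y : AddSubgroup M) (b : ℕ) : Prop :=
  ∀ (ι : Type) (s : Finset ι) (A : ι → AddSubgroup M), (∀ i ∈ s, P (A i) ∧ A i ≠ ⊥) →
    s.SupIndep A → Disjoint (s.sup A) y → s.card ≤ b

theorem DirectBound.top (P : AddSubgroup M → Prop) : DirectBound P ⊤ 0 := by
  intro ι s A hA _ hd
  rw [disjoint_top] at hd
  rw [nonpos_iff_eq_zero, Finset.card_eq_zero, Finset.eq_empty_iff_forall_notMem]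
  exact fun i hi => (hA i hi).2 (le_bot_iff.1 (hd ▸ Finset.le_sup (f := A) hi))

theorem sup_inf_sup_eq_of_disjoint {C a b : AddSubgroup M} (h : Disjoint a (C ⊔ b)) :
    (C ⊔ a) ⊓ (C ⊔ b) = C := by
  rw [sup_inf_assoc_of_le a (le_sup_left : C ≤ C ⊔ b), h.eq_bot, sup_bot_eq]

/-- Split the family at a maximal subfamily `S` whose sum misses `x`, so `S` has at most `a`
members. For every other `j` the sum of `S` and `A j` meets `x`. These intersections are independent
and miss `y`, so there are at most `b` of them. -/
theorem DirectBound.inf {P : AddSubgroup M → Prop} (hP : IsSumClosed P) {x y : AddSubgroup M}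
    (hPx : P x) {a b : ℕ} (hx : DirectBound P x a) (hy : DirectBound P y b) :
    DirectBound P (x ⊓ y) (a + b) := by
  classical
  intro ι s A hA hs hd
  obtain ⟨S, hS⟩ := (s.powerset.filter fun S => Disjoint (S.sup A) x).exists_maximal
    ⟨∅, by simp⟩
  have hSs : S ⊆ s := by simpa using (Finset.mem_filter.1 hS.1).1
  have hSx : Disjoint (S.sup A) x := (Finset.mem_filter.1 hS.1).2
  have h1 : S.card ≤ a := hx ι S A (fun i hi => hA i (hSs hi)) (hs.subset hSs) hSx
  have h2 : (s \ S).card ≤ b := by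
    refine hy ι (s \ S) (fun j => (S.sup A ⊔ A j) ⊓ x) (fun j hj => ⟨?_, fun hbot => ?_⟩) ?_ ?_
    · rw [Finset.mem_sdiff] at hj
      exact hP.inf (hP.sup (hP.finset_sup S fun i hi => (hA i (hSs hi)).1) (hA j hj.1).1) hPx
    · rw [Finset.mem_sdiff] at hj
      have hmem : insert j S ∈ s.powerset.filter fun S => Disjoint (S.sup A) x := by
        rw [Finset.mem_filter, Finset.mem_powerset]
        refine ⟨Finset.insert_subset hj.1 hSs, ?_⟩
        rw [Finset.sup_insert, sup_comm]
        exact disjoint_iff.2 hbot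
      exact hj.2 (hS.2 hmem (Finset.subset_insert j S) (Finset.mem_insert_self j S))
    · intro t ht i hi hit
      rw [Finset.mem_sdiff] at hi
      have hle : t.sup (fun j => (S.sup A ⊔ A j) ⊓ x) ≤ (S.sup A ⊔ t.sup A) ⊓ x :=
        Finset.sup_le fun j hj => inf_le_inf_right _
          (sup_le_sup_left (Finset.le_sup (f := A) hj) _)
      have hdis : Disjoint (A i) (S.sup A ⊔ t.sup A) := by
        rw [← Finset.sup_union]
        refine hs (Finset.union_subset hSs fun j hj => (Finset.mem_sdiff.1 (ht hj)).1) hi.1 ?_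
        simp [hi.2, hit]
      refine Disjoint.mono_right hle (disjoint_iff_inf_le.2 ?_)
      calc (S.sup A ⊔ A i) ⊓ x ⊓ ((S.sup A ⊔ t.sup A) ⊓ x)
          ≤ ((S.sup A ⊔ A i) ⊓ (S.sup A ⊔ t.sup A)) ⊓ x :=
            le_inf (inf_le_inf inf_le_left inf_le_left) (inf_le_left.trans inf_le_right)
        _ = ⊥ := by rw [sup_inf_sup_eq_of_disjoint hdis, hSx.eq_bot]
        _ ≤ ⊥ := le_rfl
    · have hle : (s \ S).sup (fun j => (S.sup A ⊔ A j) ⊓ x) ≤ s.sup A ⊓ x :=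
        Finset.sup_le fun j hj => inf_le_inf_right _ (sup_le (Finset.sup_mono hSs)
          (Finset.le_sup (f := A) (Finset.mem_sdiff.1 hj).1))
      refine Disjoint.mono_left hle ?_
      rw [disjoint_iff, inf_assoc]
      exact hd.eq_bot
  have := Finset.card_sdiff_add_card_eq_card hSs
  omega

theorem DirectBound.finset_inf {P : AddSubgroup M → Prop} (hP : IsSumClosed P) {ι : Type*}
    {x : ι → AddSubgroup M} (hPx : ∀ i, P (x i)) {a : ℕ} (hx : ∀ i, DirectBound P (x i) a)
    (s : Finset ι) : DirectBound P (s.inf x) (s.card * a) := by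
  classical
  induction s using Finset.induction_on with
  | empty => simpa using DirectBound.top P
  | insert i s hi ih =>
    rw [Finset.inf_insert, Finset.card_insert_of_notMem hi, Nat.succ_mul, add_comm]
    exact (hx i).inf hP (hPx i) ih

theorem iSupIndep_of_finset {ι : Type*} {A : ι → AddSubgroup M}
    (h : ∀ s : Finset ι, s.SupIndep A) : iSupIndep A := by
  rw [← iSupIndep_map_orderIso_iff (AddSubgroup.toIntSubmodule (M := M)), iSupIndep_iff_supIndep]
  intro s t ht i hi hit
  have := h s ht hi hit
  rw [← disjoint_map_orderIso_iff (AddSubgroup.toIntSubmodule (M := M)), map_finset_sup] at this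
  exact this

/-- All terms before `A n` lie in `D n`, which `A n` misses. -/
theorem iSupIndep_of_disjoint_monotone {A D : ℕ → AddSubgroup M} (hD : Monotone D)
    (hA : ∀ n, A n ≤ D (n + 1)) (h : ∀ n, Disjoint (A n) (D n)) : iSupIndep A := by
  have key : ∀ n, (Finset.range n).SupIndep A := by
    intro n
    induction n with
    | zero => simp
    | succ n ih =>
      rw [Finset.range_add_one]
      refine ih.insert ((h n).mono_right (Finset.sup_le fun i hi => ?_))
      exact (hA i).trans (hD (Finset.mem_range.1 hi))
  refine iSupIndep_of_finset fun s => ?_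
  obtain ⟨n, hn⟩ := s.exists_nat_subset_range
  exact (key n).subset hn

theorem iSupIndep_of_disjoint_antitone {A D : ℕ → AddSubgroup M} (hD : Antitone D)
    (hA : ∀ n, A n ≤ D n) (h : ∀ n, Disjoint (A n) (D (n + 1))) : iSupIndep A := by
  -- The induction must carry along that the first `n` terms miss `D n`, where all later terms live.
  have key : ∀ n, (Finset.range n).SupIndep A ∧ Disjoint ((Finset.range n).sup A) (D n) := by
    intro n
    induction n with
    | zero => simp
    | succ n ih =>
      rw [Finset.range_add_one, Finset.sup_insert]
      have hn := ih.2.symm.mono_left (hA n)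
      refine ⟨ih.1.insert hn, ?_⟩
      rw [sup_comm]
      exact (h n).disjoint_sup_left_of_disjoint_sup_right
        (ih.2.mono_right (sup_le (hA n) (hD n.le_succ)))
  refine iSupIndep_of_finset fun s => ?_
  obtain ⟨n, hn⟩ := s.exists_nat_subset_range
  exact (key n).1.subset hn

end DirectSums

/-! ### Finite uniform dimension -/

section UniformDimension

variable {R : Type*} [NonUnitalRing R] {P : AddSubgroup R → Prop}

/-- An infinite ascending chain in which each step gains a nonzero member of `P` missing the
previous term would make the gained members an infinite direct sum. This gives Noetherian induction;
`wellFounded_down` is the Artinian counterpart. -/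
theorem HasFiniteUDim.wellFounded_up (h : HasFiniteUDim P) :
    WellFounded fun N N' : AddSubgroup R =>
      N' ≤ N ∧ ∃ A, P A ∧ A ≠ ⊥ ∧ A ≤ N ∧ Disjoint A N' := by
  rw [wellFounded_iff_isEmpty_descending_chain]
  refine ⟨fun ⟨D, hD⟩ => h ?_⟩
  choose hle A hPA hne hA hd using hD
  exact ⟨A, fun n => ⟨hPA n, hne n⟩,
    iSupIndep_of_disjoint_monotone (monotone_nat_of_le_succ hle) hA hd⟩

theorem HasFiniteUDim.wellFounded_down (h : HasFiniteUDim P) :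
    WellFounded fun N N' : AddSubgroup R =>
      N ≤ N' ∧ ∃ A, P A ∧ A ≠ ⊥ ∧ A ≤ N' ∧ Disjoint A N := by
  rw [wellFounded_iff_isEmpty_descending_chain]
  refine ⟨fun ⟨D, hD⟩ => h ?_⟩
  choose hle A hPA hne hA hd using hD
  exact ⟨A, fun n => ⟨hPA n, hne n⟩,
    iSupIndep_of_disjoint_antitone (antitone_nat_of_succ_le hle) hA hd⟩

/-- Noetherian induction on `y`. If the bound `1` fails, there are two independent members whose sum
misses `y`. Then `y` is the intersection of the two larger subgroups obtained by adding each of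
them, and their bounds add up. -/
theorem HasFiniteUDim.exists_directBound (hP : IsSumClosed P) (h : HasFiniteUDim P)
    (y : AddSubgroup R) (hy : P y) : ∃ b, DirectBound P y b := by
  classical
  induction y using h.wellFounded_up.induction with
  | _ y ih =>
  by_contra! hbig
  have h1 := hbig 1
  unfold DirectBound at h1
  push Not at h1
  obtain ⟨ι, s, A, hA, hs, hd, hcard⟩ := h1
  obtain ⟨i, hi, j, hj, hij⟩ := Finset.one_lt_card.1 hcard
  have hbound : ∀ k ∈ s, ∃ b, DirectBound P (y ⊔ A k) b := fun k hk =>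
    ih _ ⟨le_sup_left, A k, (hA k hk).1, (hA k hk).2, le_sup_right,
      hd.mono_left (Finset.le_sup (f := A) hk)⟩ (hP.sup hy (hA k hk).1)
  obtain ⟨a, ha⟩ := hbound i hi
  obtain ⟨b, hb⟩ := hbound j hj
  have hab := ha.inf hP (hP.sup hy (hA i hi).1) hb
  rw [sup_inf_sup_eq_of_disjoint] at hab
  · exact hbig _ hab
  · rw [sup_comm]
    refine Disjoint.disjoint_sup_right_of_disjoint_sup_left ?_ ?_
    · simpa using hs (t := {j}) (by simpa using hj) hi (by simpa using hij)
    · exact hd.mono_left (sup_le (Finset.le_sup (f := A) hi) (Finset.le_sup (f := A) hj))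

theorem uDim_le_iff {b : ℕ} : uDim P ≤ b ↔ DirectBound P ⊥ b := by
  unfold uDim
  rw [iSup₂_le_iff]
  constructor
  · intro h ι s A hA hs _
    have := h s.card ⟨fun i => A (s.equivFin.symm i), fun i => hA _ (s.equivFin.symm i).2, ?_⟩
    · exact_mod_cast this
    · exact ((iSupIndep_comp_coe_iff_supIndep (f := A) (s := s)).2 hs).comp
        s.equivFin.symm.injective
  · rintro h n ⟨I, hI, hind⟩
    have := h (Fin n) Finset.univ I (fun i _ => hI i) (iSupIndep_iff_supIndep_univ.1 hind)
      disjoint_bot_right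
    simpa using this

theorem HasFiniteUDim.uDim_lt_top (hP : IsSumClosed P) (h : HasFiniteUDim P) : uDim P < ⊤ := by
  obtain ⟨b, hb⟩ := h.exists_directBound hP ⊥ hP.bot
  exact (uDim_le_iff.2 hb).trans_lt (ENat.natCast_lt_top b)

theorem hasFiniteUDim_of_uDim_lt_top (h : uDim P < ⊤) : HasFiniteUDim P := by
  rintro ⟨I, hI, hind⟩
  obtain ⟨b, hb⟩ := ENat.ne_top_iff_exists.1 h.ne
  have hb' := uDim_le_iff.1 hb.ge ℕ (Finset.range (b + 1)) I (fun i _ => hI i) (hind.supIndep' _)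
    disjoint_bot_right
  simp at hb'

theorem isSumClosed_isLeftIdeal : IsSumClosed (IsLeftIdeal (R := R)) where
  inf hA hB := fun r x hx => ⟨hA r x hx.1, hB r x hx.2⟩
  sSup {s} hs := fun r x hx => by
    have : sSup s ≤ (sSup s).comap (AddMonoidHom.mulLeft r) :=
      sSup_le fun A hA y hy => le_sSup hA (hs A hA r y hy)
    exact this hx

end UniformDimension

/-! ### Semiprimeness, the trace and the Bergman–Isaacs theorem -/

section Trace

variable {R : Type*} [NonUnitalRing R]

theorem IsSemiprimeRing.eq_zero_of_mul_mul (h : IsSemiprimeRing R) {a : R}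
    (ha : ∀ r, a * r * a = 0) : a = 0 := by
  -- Without an identity, `R * a * R = 0` does not at once give `a = 0`. The one-sided annihilators
  -- of `R` are therefore disposed of first, as ideals of square zero.
  have hl : ∀ x : R, (∀ r, r * x = 0) → x = 0 := by
    intro x hx
    let I : AddSubgroup R :=
      { carrier := {x | ∀ r, r * x = 0}
        zero_mem' := fun r => mul_zero r
        add_mem' := fun {a b} ha hb r => by rw [mul_add, ha r, hb r, add_zero]
        neg_mem' := fun {a} ha r => by rw [mul_neg, ha r, neg_zero] }
    have hI : I = ⊥ := h I (fun r x hx s => by rw [← mul_assoc]; exact hx _)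
      (fun r x hx s => by rw [← mul_assoc, hx s, zero_mul]) (fun x _ y hy => hy x)
    exact (AddSubgroup.mem_bot).1 (hI ▸ (show x ∈ I from hx))
  have hr : ∀ x : R, (∀ r, x * r = 0) → x = 0 := by
    intro x hx
    let I : AddSubgroup R :=
      { carrier := {x | ∀ r, x * r = 0}
        zero_mem' := fun r => zero_mul r
        add_mem' := fun {a b} ha hb r => by rw [add_mul, ha r, hb r, add_zero]
        neg_mem' := fun {a} ha r => by rw [neg_mul, ha r, neg_zero] }
    have hI : I = ⊥ := h I (fun r x hx s => by rw [mul_assoc, hx s, mul_zero])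
      (fun r x hx s => by rw [mul_assoc]; exact hx _) (fun x hx y _ => hx y)
    exact (AddSubgroup.mem_bot).1 (hI ▸ (show x ∈ I from hx))
  let X : Set R := {x | ∃ r s, x = r * a * s}
  have hX : AddSubgroup.closure X = ⊥ := by
    apply h
    · intro r x hx
      have : AddSubgroup.closure X ≤ (AddSubgroup.closure X).comap (AddMonoidHom.mulLeft r) := by
        rw [AddSubgroup.closure_le]
        rintro _ ⟨t, s, rfl⟩
        exact AddSubgroup.subset_closure ⟨r * t, s, by simp [mul_assoc]⟩
      exact this hx
    · intro r x hx
      have : AddSubgroup.closure X ≤ (AddSubgroup.closure X).comap (AddMonoidHom.mulRight r) := by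
        rw [AddSubgroup.closure_le]
        rintro _ ⟨t, s, rfl⟩
        exact AddSubgroup.subset_closure ⟨t, s * r, by simp [mul_assoc]⟩
      exact this hx
    · intro x hx y hy
      have h1 : ∀ y ∈ X, AddSubgroup.closure X ≤ (AddMonoidHom.mulRight y).ker := by
        rintro _ ⟨r, s, rfl⟩
        rw [AddSubgroup.closure_le]
        rintro _ ⟨r', s', rfl⟩
        change r' * a * s' * (r * a * s) = 0
        calc r' * a * s' * (r * a * s) = r' * (a * (s' * r) * a) * s := by simp only [mul_assoc]
          _ = 0 := by rw [ha, mul_zero, zero_mul]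
      have h2 : AddSubgroup.closure X ≤ (AddMonoidHom.mulLeft x).ker := by
        rw [AddSubgroup.closure_le]
        exact fun y hy => h1 y hy hx
      exact h2 hy
  refine hr a fun s => hl _ fun r => ?_
  rw [← mul_assoc]
  exact (AddSubgroup.mem_bot).1 (hX ▸ AddSubgroup.subset_closure ⟨r, s, rfl⟩)

variable {Γ : Type*} [Group Γ] {α : Γ →* RingAut R}

/-- Closure of a group of functions `Γ → R` under the right multiplication of the skew group
ring by elements of `R`. -/
def IsTwistedRightSubmodule (α : Γ →* RingAut R) (X : AddSubgroup (Γ → R)) : Prop :=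
  ∀ (r : R) (v : Γ → R), v ∈ X → (fun g => v g * α g r) ∈ X

theorem isSumClosed_isTwistedRightSubmodule : IsSumClosed (IsTwistedRightSubmodule α) where
  inf hA hB := fun r x hx => ⟨hA r x hx.1, hB r x hx.2⟩
  sSup {s} hs := fun r x hx => by
    let φ : (Γ → R) →+ (Γ → R) :=
      { toFun := fun v g => v g * α g r
        map_zero' := by ext; simp
        map_add' := fun v w => by ext; simp [add_mul] }
    have : sSup s ≤ (sSup s).comap φ :=
      sSup_le fun A hA y hy => le_sSup hA (hs A hA r y hy)
    exact this hx

/-- Right translation of functions on a group. -/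
def translate (R : Type*) [NonUnitalRing R] (h : Γ) : (Γ → R) →+ (Γ → R) where
  toFun := fun v g => v (g * h)
  map_zero' := rfl
  map_add' := fun _ _ => rfl

theorem isTwistedRightSubmodule_comap_translate {X : AddSubgroup (Γ → R)}
    (hX : IsTwistedRightSubmodule α X) (h : Γ) :
    IsTwistedRightSubmodule α (X.comap (translate R h)) := by
  intro r v hv
  have := hX (α h r) _ hv
  rw [AddSubgroup.mem_comap]
  convert this using 1
  ext g
  simp [translate, map_mul]

theorem isTwistedRightSubmodule_map_translate {X : AddSubgroup (Γ → R)}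
    (hX : IsTwistedRightSubmodule α X) (h : Γ) :
    IsTwistedRightSubmodule α (X.map (translate R h)) := by
  rintro r _ ⟨v, hv, rfl⟩
  refine ⟨_, hX (α h⁻¹ r) v hv, ?_⟩
  ext g
  simp [translate, map_mul]

theorem translate_translate (g h : Γ) (v : Γ → R) :
    translate R g (translate R h v) = translate R (g * h) v := by
  ext x
  simp [translate, mul_assoc]

theorem translate_one (v : Γ → R) : translate R 1 v = v := by
  ext x
  simp [translate]

variable [Fintype Γ] (α)

/-- The trace map of a finite group action. -/
def trace (r : R) : R := ∑ g, α g r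

variable {α}

theorem apply_trace (h : Γ) (r : R) : α h (trace α r) = trace α r := by
  simp only [trace, map_sum]
  exact Fintype.sum_equiv (Equiv.mulLeft h) _ _ fun g => by simp [map_mul]

theorem trace_mul_right {c : R} (hc : ∀ g, α g c = c) (r : R) :
    trace α (r * c) = trace α r * c := by
  simp [trace, Finset.sum_mul, hc]

theorem trace_mem {J : AddSubgroup R} (hJ : ∀ g, ∀ x ∈ J, α g x ∈ J) {x : R} (hx : x ∈ J) :
    trace α x ∈ J :=
  AddSubgroup.sum_mem _ fun g _ => hJ g x hx

/-- The functions `w : Γ → R` for which `∑ g, w g * α g j = 0` for all `j ∈ J`. -/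
def twistedAnnihilator (α : Γ →* RingAut R) (J : AddSubgroup R) : AddSubgroup (Γ → R) where
  carrier := {w | ∀ j ∈ J, ∑ g, w g * α g j = 0}
  zero_mem' := fun j _ => by simp
  add_mem' := fun {a b} ha hb j hj => by
    simp only [Pi.add_apply, add_mul, Finset.sum_add_distrib, ha j hj, hb j hj, add_zero]
  neg_mem' := fun {a} ha j hj => by
    simp only [Pi.neg_apply, neg_mul, Finset.sum_neg_distrib, ha j hj, neg_zero]

theorem translate_mem_twistedAnnihilator {J : AddSubgroup R} (hJG : ∀ g, ∀ x ∈ J, α g x ∈ J)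
    (h : Γ) {w : Γ → R} (hw : w ∈ twistedAnnihilator α J) :
    translate R h w ∈ twistedAnnihilator α J := by
  intro j hj
  rw [← hw (α h⁻¹ j) (hJG _ _ hj)]
  refine Fintype.sum_equiv (Equiv.mulRight h) _ _ fun g => ?_
  simp [translate, map_mul]

theorem isTwistedRightSubmodule_twistedAnnihilator {J : AddSubgroup R} (hJ : IsLeftIdeal J) :
    IsTwistedRightSubmodule α (twistedAnnihilator α J) := by
  intro r w hw j hj
  rw [← hw (r * j) (hJ r j hj)]
  exact Finset.sum_congr rfl fun g _ => by rw [map_mul, mul_assoc]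

/-- A form of the Bergman–Isaacs theorem, proved through an essential version of Maschke's
theorem: the annihilator of `J` in the skew group ring is an essential right submodule. -/
theorem isEssential_twistedAnnihilator {J : AddSubgroup R} (hJ : IsLeftIdeal J)
    (hJG : ∀ g, ∀ x ∈ J, α g x ∈ J) (htf : ∀ x ∈ J, Fintype.card Γ • x = 0 → x = 0)
    (htr : ∀ x ∈ J, ∀ y ∈ J, x * trace α y = 0) :
    IsEssential (IsTwistedRightSubmodule α) (twistedAnnihilator α J) := by
  classical
  have hP := isSumClosed_isTwistedRightSubmodule (α := α)
  set W := twistedAnnihilator α J with hW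
  have hPW : IsTwistedRightSubmodule α W := isTwistedRightSubmodule_twistedAnnihilator hJ
  obtain ⟨L, hPL, hLW, hess⟩ := exists_essential_complement hP W
  -- `W` is stable under translation by `Γ` but `L` need not be, so all translates of `L` are used.
  -- The finite intersection of the sums with `W` is still essential, and it is shown to lie in `W`.
  have hess' : ∀ h, IsEssential (IsTwistedRightSubmodule α) (W ⊔ L.comap (translate R h)) := by
    intro h X hX hd
    have h0 : X.map (translate R h) = ⊥ := by
      refine hess _ (isTwistedRightSubmodule_map_translate hX h) ?_
      rw [AddSubgroup.disjoint_def]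
      rintro _ ⟨x, hx, rfl⟩ hxL
      obtain ⟨w, hw, l, hl, hwl⟩ := AddSubgroup.mem_sup.1 hxL
      have hx0 : x = 0 := by
        refine AddSubgroup.disjoint_def.1 hd hx (AddSubgroup.mem_sup.2
          ⟨translate R h⁻¹ w, translate_mem_twistedAnnihilator hJG _ hw, translate R h⁻¹ l, ?_, ?_⟩)
        · rwa [AddSubgroup.mem_comap, translate_translate, mul_inv_cancel, translate_one]
        · rw [← map_add, hwl, translate_translate, inv_mul_cancel, translate_one]
      rw [hx0, map_zero]
    rw [eq_bot_iff]
    intro x hx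
    have : translate R h x = 0 :=
      (AddSubgroup.mem_bot).1 (h0 ▸ AddSubgroup.mem_map_of_mem _ hx)
    rw [AddSubgroup.mem_bot, ← translate_one x, ← inv_mul_cancel h, ← translate_translate, this,
      map_zero]
  have hE := IsEssential.iInf hP hess' (fun h => hP.sup hPW
    (isTwistedRightSubmodule_comap_translate hPL h)) Finset.univ
  refine hE.mono fun v hv j hj => ?_
  have hv' : ∀ h, ∃ w ∈ W, ∃ l ∈ L.comap (translate R h), w + l = v := fun h =>
    AddSubgroup.mem_sup.1 ((Finset.inf_le (f := fun h => W ⊔ L.comap (translate R h))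
      (Finset.mem_univ h)) hv)
  choose w hw l hl hwl using hv'
  set c : R := ∑ g, v g * α g j with hc
  have hcJ : c ∈ J := AddSubgroup.sum_mem _ fun g _ => hJ _ _ (hJG g j hj)
  -- The constant function is `c` times the trace element of the skew group ring, and it kills `J`
  -- because `J * trace J = 0`.
  have hcW : (fun _ => c : Γ → R) ∈ W := by
    intro i hi
    rw [← Finset.mul_sum]
    exact htr c hcJ i hi
  -- Averaging splits the constant function into a `W`-part `y` and a part `z`. The latter lies in
  -- `W` by subtraction and has a translate in `L`, so it vanishes; evaluate `y` at `1`.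
  have key : ∀ k, ∑ h : Γ, w (k * h) h * α h j = c := by
    intro k
    let y : Γ → R := ∑ h, translate R h fun g => w (k * h) g * α g j
    let z : Γ → R := ∑ h, translate R h fun g => l (k * h) g * α g j
    have hyz : y + z = fun _ => c := by
      ext g
      simp only [y, z, translate, Pi.add_apply, Finset.sum_apply, AddMonoidHom.coe_mk,
        ZeroHom.coe_mk]
      rw [← Finset.sum_add_distrib, hc]
      refine Fintype.sum_equiv (Equiv.mulLeft g) _ _ fun h => ?_
      rw [← add_mul, ← Pi.add_apply, hwl]
      rfl
    have hyW : y ∈ W := AddSubgroup.sum_mem _ fun h _ =>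
      translate_mem_twistedAnnihilator hJG _ (hPW j _ (hw _))
    have hzW : z ∈ W := by
      have : z = (fun _ => c) - y := by rw [← hyz]; abel
      rw [this]
      exact W.sub_mem hcW hyW
    have hzL : translate R k z ∈ L := by
      simp only [z, map_sum]
      refine AddSubgroup.sum_mem _ fun h _ => ?_
      rw [translate_translate]
      exact isTwistedRightSubmodule_comap_translate hPL (k * h) j _ (hl (k * h))
    have hz0 : z = 0 := by
      have : translate R k z = 0 :=
        AddSubgroup.disjoint_def.1 hLW hzL (translate_mem_twistedAnnihilator hJG k hzW)
      rw [← translate_one z, ← inv_mul_cancel k, ← translate_translate, this, map_zero]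
    rw [hz0, add_zero] at hyz
    have := congrFun hyz 1
    simpa [y, translate] using this
  refine htf c hcJ ?_
  -- Summing over `k` and reindexing `k * h` as `k` turns the double sum into the defining relations
  -- of `w k ∈ W`, so `|Γ| • c = 0`.
  have h1 : ∑ k : Γ, ∑ h : Γ, w (k * h) h * α h j = Fintype.card Γ • c := by
    rw [Finset.sum_congr rfl fun k _ => key k, Finset.sum_const, Finset.card_univ]
  rw [← h1, Finset.sum_comm]
  have h2 : ∀ h : Γ, ∑ k, w (k * h) h * α h j = ∑ k, w k h * α h j := fun h =>
    Fintype.sum_equiv (Equiv.mulRight h) _ _ fun k => rfl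
  rw [Finset.sum_congr rfl fun h _ => h2 h, Finset.sum_comm]
  exact Finset.sum_eq_zero fun k _ => hw k j hj

/-- The Bergman–Isaacs theorem for invariant left ideals of semiprime rings. -/
theorem eq_bot_of_mul_trace_eq_zero (hR : ∀ a : R, (∀ r, a * r * a = 0) → a = 0)
    {J : AddSubgroup R} (hJ : IsLeftIdeal J) (hJG : ∀ g, ∀ x ∈ J, α g x ∈ J)
    (htf : ∀ x ∈ J, Fintype.card Γ • x = 0 → x = 0)
    (htr : ∀ x ∈ J, ∀ y ∈ J, x * trace α y = 0) : J = ⊥ := by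
  classical
  have hW := isEssential_twistedAnnihilator hJ hJG htf htr
  rw [eq_bot_iff]
  intro j hj
  rw [AddSubgroup.mem_bot]
  let φ : R →+ (Γ → R) := (AddMonoidHom.single (fun _ : Γ => R) 1).comp (AddMonoidHom.mulLeft j)
  have hφ : ∀ r, φ r = Pi.single 1 (j * r) := fun r => rfl
  -- `j * R`, placed at the identity of `Γ`, is a submodule. It misses `W`: if `j * r` kills `R *
  -- j`, then `j * r * s * (j * r) = 0` for all `s`.
  have hX : φ.range = ⊥ := by
    refine hW _ ?_ ?_
    · rintro s _ ⟨r, rfl⟩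
      refine ⟨r * s, ?_⟩
      ext g
      rw [hφ, hφ]
      by_cases hg : g = 1
      · subst hg; simp [mul_assoc]
      · simp [hg]
    · rw [AddSubgroup.disjoint_def]
      rintro _ ⟨r, rfl⟩ hr
      have h1 : j * r = 0 := by
        refine hR _ fun s => ?_
        have := hr (s * j) (hJ s j hj)
        rw [Finset.sum_eq_single 1 (fun g _ hg => by simp [hφ, hg]) (by simp)] at this
        simp only [hφ, Pi.single_eq_same, map_one, RingAut.one_apply] at this
        calc j * r * s * (j * r) = j * r * (s * j) * r := by simp only [mul_assoc]
          _ = 0 := by rw [this, zero_mul]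
      rw [hφ, h1, Pi.single_zero]
  refine hR j fun r => ?_
  have : φ r = 0 := (AddSubgroup.mem_bot).1 (hX ▸ ⟨r, rfl⟩)
  have := congrFun this 1
  simp only [hφ, Pi.single_eq_same, Pi.zero_apply] at this
  rw [this, zero_mul]

end Trace

/-! ### Singular ideals and Goldie's theorem without identity -/

section Goldie

variable {A : Type*} [NonUnitalRing A]

theorem isLeftIdeal_ker_mulRight (x : A) : IsLeftIdeal (AddMonoidHom.mulRight x).ker :=
  fun r y hy => by
    change r * y * x = 0
    rw [mul_assoc, show y * x = 0 from hy, mul_zero]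

theorem IsLeftIdeal.map_mulRight {I : AddSubgroup A} (hI : IsLeftIdeal I) (x : A) :
    IsLeftIdeal (I.map (AddMonoidHom.mulRight x)) := by
  rintro r _ ⟨y, hy, rfl⟩
  exact ⟨r * y, hI r y hy, mul_assoc r y x⟩

theorem IsLeftIdeal.comap_mulRight {I : AddSubgroup A} (hI : IsLeftIdeal I) (x : A) :
    IsLeftIdeal (I.comap (AddMonoidHom.mulRight x)) := by
  intro r y hy
  change r * y * x ∈ I
  rw [mul_assoc]
  exact hI r _ hy

theorem isLeftIdeal_range_mulRight (x : A) : IsLeftIdeal (AddMonoidHom.mulRight x).range := by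
  rintro r _ ⟨y, rfl⟩
  exact ⟨r * y, mul_assoc r y x⟩

/-- If `I` misses the preimage, then `I * x` misses `E` and is zero. But then `I` lies in the
preimage. -/
theorem IsEssential.comap_mulRight {E : AddSubgroup A} (hE : IsEssential IsLeftIdeal E) (x : A) :
    IsEssential IsLeftIdeal (E.comap (AddMonoidHom.mulRight x)) := by
  intro I hI hd
  have h0 : I.map (AddMonoidHom.mulRight x) = ⊥ := by
    refine hE _ (hI.map_mulRight x) (AddSubgroup.disjoint_def.2 ?_)
    rintro _ ⟨y, hy, rfl⟩ hyE
    rw [AddSubgroup.disjoint_def.1 hd hy hyE, map_zero]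
  rw [eq_bot_iff]
  intro y hy
  have hyx : y * x = 0 := (AddSubgroup.mem_bot).1
    (h0 ▸ AddSubgroup.mem_map_of_mem (AddMonoidHom.mulRight x) hy)
  refine AddSubgroup.disjoint_def.1 hd hy ?_
  change y * x ∈ E
  rw [hyx]
  exact E.zero_mem

/-- The ascending chain condition on left annihilators of elements. -/
def HasElementACC (A : Type*) [NonUnitalRing A] : Prop :=
  WellFounded fun a b : A => (AddMonoidHom.mulRight b).ker < (AddMonoidHom.mulRight a).ker

theorem IsLeftGoldie.hasElementACC (h : IsLeftGoldie A) : HasElementACC A := by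
  unfold HasElementACC
  rw [wellFounded_iff_isEmpty_descending_chain]
  refine ⟨fun ⟨a, ha⟩ => ?_⟩
  have key : ∀ x : A, leftAnn {x} = ((AddMonoidHom.mulRight x).ker : Set A) := fun x => by
    ext r
    simp [leftAnn]
  have hmono : Monotone fun n => leftAnn {a n} := by
    refine monotone_nat_of_le_succ fun n => ?_
    rw [key, key]
    exact (ha n).le
  obtain ⟨N, hN⟩ := h.2 (fun n => {a n}) (fun n => Set.singleton_nonempty _) hmono
  have := hN (N + 1) N.le_succ
  rw [key, key, SetLike.coe_set_eq] at this
  exact (ha N).ne this.symm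

/-- The left singular ideal is zero. -/
def IsLeftNonsingular (A : Type*) [NonUnitalRing A] : Prop :=
  ∀ z : A, IsEssential IsLeftIdeal (AddMonoidHom.mulRight z).ker → z = 0

/-- The power `c ^ (n + 1)`. -/
def succPow (c : A) (n : ℕ) : A := (c * ·)^[n] c

theorem succPow_zero (c : A) : succPow c 0 = c := rfl

theorem succPow_succ (c : A) (n : ℕ) : succPow c (n + 1) = c * succPow c n :=
  Function.iterate_succ_apply' _ _ _

theorem succPow_mul (c : A) (m n : ℕ) :
    succPow c m * succPow c n = succPow c (m + n + 1) := by
  induction m with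
  | zero => rw [succPow_zero, zero_add, succPow_succ]
  | succ m ih =>
    rw [succPow_succ, mul_assoc, ih, ← succPow_succ]
    congr 1
    omega

theorem succPow_succ' (c : A) (n : ℕ) : succPow c (n + 1) = succPow c n * c :=
  (succPow_mul c n 0).symm

theorem succPow_mul_comm (a y : A) (n : ℕ) : succPow (a * y) n * a = a * succPow (y * a) n := by
  induction n with
  | zero => simp [succPow_zero, mul_assoc]
  | succ n ih => rw [succPow_succ, succPow_succ, mul_assoc, ih]; simp only [mul_assoc]

theorem IsLeftIdeal.succPow_mem {I : AddSubgroup A} (hI : IsLeftIdeal I) {c : A} (hc : c ∈ I)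
    (n : ℕ) : succPow c n ∈ I := by
  cases n with
  | zero => exact hc
  | succ n =>
    rw [succPow_succ']
    exact hI _ _ hc

/-- If `I` misses `A * c`, then `I`, `I * c`, `I * c ^ 2`, … form an infinite direct sum, because
right multiplication by `c` is injective. -/
theorem isEssential_range_mulRight (hfin : HasFiniteUDim (R := A) IsLeftIdeal) {c : A}
    (hc : ∀ x, x * c = 0 → x = 0) : IsEssential IsLeftIdeal (AddMonoidHom.mulRight c).range := by
  intro I hI hd
  by_contra hI0
  let φ : ℕ → AddSubgroup A → AddSubgroup A := fun n X => (·.map (AddMonoidHom.mulRight c))^[n] X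
  have hinj : Function.Injective (AddMonoidHom.mulRight c) :=
    (injective_iff_map_eq_zero _).2 hc
  have hsucc : ∀ n X, φ (n + 1) X = (φ n X).map (AddMonoidHom.mulRight c) := fun n X =>
    Function.iterate_succ_apply' _ _ _
  have hmono : ∀ n X Y, X ≤ Y → φ n X ≤ φ n Y := by
    intro n X Y h
    induction n with
    | zero => exact h
    | succ n ih => rw [hsucc, hsucc]; exact AddSubgroup.map_mono ih
  have hdis : ∀ n X Y, Disjoint X Y → Disjoint (φ n X) (φ n Y) := by
    intro n X Y h
    induction n with
    | zero => exact h
    | succ n ih => rw [hsucc, hsucc]; exact AddSubgroup.disjoint_map hinj ih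
  refine hfin ⟨fun n => φ n I, fun n => ⟨?_, ?_⟩,
    iSupIndep_of_disjoint_antitone (D := fun n => φ n ⊤) ?_ (fun n => hmono n _ _ le_top) ?_⟩
  · induction n with
    | zero => exact hI
    | succ n ih => dsimp only; rw [hsucc]; exact ih.map_mulRight c
  · induction n with
    | zero => exact hI0
    | succ n ih => dsimp only; rw [hsucc]; rwa [ne_eq, AddSubgroup.map_eq_bot_iff_of_injective _ hinj]
  · refine antitone_nat_of_succ_le fun n => ?_
    change φ n (AddSubgroup.map _ ⊤) ≤ _
    exact hmono n _ _ le_top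
  · intro n
    change Disjoint (φ n I) (φ n (AddSubgroup.map _ ⊤))
    refine hdis n _ _ ?_
    rwa [← AddMonoidHom.range_eq_map]

/-- If `c * x = 0`, then `x` is annihilated by the essential left ideal `A * c`, so it is singular.
-/
theorem isRegular_of_forall_mul_eq_zero (hfin : HasFiniteUDim (R := A) IsLeftIdeal)
    (hns : IsLeftNonsingular A) {c : A} (hc : ∀ x, x * c = 0 → x = 0) : IsRegular c := by
  have hr : ∀ x, c * x = 0 → x = 0 := by
    intro x hx
    refine hns x ((isEssential_range_mulRight hfin hc).mono ?_)
    rintro _ ⟨y, rfl⟩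
    change y * c * x = 0
    rw [mul_assoc, hx, mul_zero]
  refine ⟨fun x y h => sub_eq_zero.1 (hr _ ?_), fun x y h => sub_eq_zero.1 (hc _ ?_)⟩
  · rw [mul_sub]; exact sub_eq_zero.2 h
  · rw [sub_mul]; exact sub_eq_zero.2 h

/-- A left nonsingular ring of finite left uniform dimension is left Goldie. -/
theorem IsLeftNonsingular.isLeftGoldie (hns : IsLeftNonsingular A)
    (hfin : HasFiniteUDim (R := A) IsLeftIdeal) : IsLeftGoldie A := by
  refine ⟨hfin, fun X hX hmono => ?_⟩
  let D : ℕ → AddSubgroup A := fun n => ⨅ x ∈ X n, (AddMonoidHom.mulRight x).ker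
  have hmem : ∀ n r, r ∈ D n ↔ ∀ x ∈ X n, r * x = 0 := fun n r => by
    simp [D, AddSubgroup.mem_iInf]
  have hD : ∀ n, leftAnn (X n) = D n := fun n => by
    ext r
    rw [SetLike.mem_coe, hmem]
    rfl
  have hDl : ∀ n, IsLeftIdeal (D n) := fun n r y hy => by
    rw [hmem] at hy ⊢
    intro x hx
    rw [mul_assoc, hy x hx, mul_zero]
  have hmono' : Monotone D := fun m n h => by
    have := hmono h
    simp only [hD] at this
    exact this
  obtain ⟨_, ⟨N, rfl⟩, hmax⟩ := hfin.wellFounded_up.has_min (Set.range D) ⟨_, 0, rfl⟩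
  refine ⟨N, fun n hn => ?_⟩
  rw [hD, hD]
  refine congrArg _ (le_antisymm (fun y hy => ?_) (hmono' hn))
  rw [hmem]
  intro x hx
  -- If `I` misses the annihilator of `y * x`, then `I * y` lies in `D n` and misses `D N`. By
  -- maximality it is zero, which makes the annihilator of `y * x` essential.
  refine hns _ fun I hI hd => ?_
  have hsub : I.map (AddMonoidHom.mulRight y) = ⊥ := by
    by_contra hne
    refine hmax _ ⟨n, rfl⟩ ⟨hmono' hn, I.map (AddMonoidHom.mulRight y), hI.map_mulRight y, hne,
      ?_, AddSubgroup.disjoint_def.2 ?_⟩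
    · rintro _ ⟨i, -, rfl⟩
      exact hDl n i y hy
    · rintro _ ⟨i, hi, rfl⟩ hiy
      have h0 : i = 0 := AddSubgroup.disjoint_def.1 hd hi (by
        change i * (y * x) = 0
        rw [← mul_assoc]
        exact (hmem N _).1 hiy x hx)
      rw [h0, map_zero]
  rw [eq_bot_iff]
  intro i hi
  refine AddSubgroup.disjoint_def.1 hd hi ?_
  have : i * y = 0 := (AddSubgroup.mem_bot).1
    (hsub ▸ AddSubgroup.mem_map_of_mem (AddMonoidHom.mulRight y) hi)
  change i * (y * x) = 0
  rw [← mul_assoc, this, zero_mul]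

variable (hs : ∀ a : A, (∀ r, a * r * a = 0) → a = 0)

include hs

theorem range_mulRight_ne_bot {x : A} (hx : x ≠ 0) : (AddMonoidHom.mulRight x).range ≠ ⊥ := by
  intro h
  refine hx (hs x fun r => ?_)
  have : r * x = 0 := (AddSubgroup.mem_bot).1 (h ▸ ⟨r, rfl⟩)
  rw [mul_assoc, this, mul_zero]

/-- Take a nonzero singular `z` with maximal left annihilator. If `z * r * z ≠ 0`, it is singular
too, and its annihilator is strictly larger: that of `r * z` is essential, hence meets `A * z`. -/
theorem HasElementACC.isLeftNonsingular (hacc : HasElementACC A) : IsLeftNonsingular A := by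
  intro z hz
  by_contra hz0
  obtain ⟨z, ⟨hz, hz0⟩, hmin⟩ := hacc.has_min
    {z : A | IsEssential IsLeftIdeal (AddMonoidHom.mulRight z).ker ∧ z ≠ 0} ⟨z, hz, hz0⟩
  refine hz0 (hs z fun r => ?_)
  by_contra hne
  have hrz : IsEssential IsLeftIdeal (AddMonoidHom.mulRight (r * z)).ker := by
    refine (hz.comap_mulRight r).mono fun y hy => ?_
    change y * (r * z) = 0
    rw [← mul_assoc]
    exact hy
  have hzrz : IsEssential IsLeftIdeal (AddMonoidHom.mulRight (z * r * z)).ker := by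
    refine hz.mono fun y hy => ?_
    change y * (z * r * z) = 0
    rw [mul_assoc z, ← mul_assoc, show y * z = 0 from hy, zero_mul]
  refine hmin _ ⟨hzrz, hne⟩ ?_
  refine lt_of_le_of_ne (fun y hy => ?_) fun heq => ?_
  · change y * (z * r * z) = 0
    rw [mul_assoc z, ← mul_assoc, show y * z = 0 from hy, zero_mul]
  · refine range_mulRight_ne_bot hs hz0 (hrz _ (isLeftIdeal_range_mulRight z)
      (AddSubgroup.disjoint_def.2 ?_))
    rintro _ ⟨y, rfl⟩ hy
    have hy' : y * (z * r * z) = 0 := by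
      have : y * z * (r * z) = 0 := hy
      rw [← this]
      simp only [mul_assoc]
    have : y ∈ (AddMonoidHom.mulRight z).ker := by
      rw [heq]
      exact hy'
    exact this

/-- A nonzero left ideal of a semiprime ring with the ascending chain condition on left
annihilators contains a nonzero element `a` such that `x * a * a = 0` implies `x * a = 0`. -/
theorem HasElementACC.exists_ker_mul_self (hacc : HasElementACC A) {I : AddSubgroup A}
    (hI : IsLeftIdeal I) (hI0 : I ≠ ⊥) :
    ∃ a ∈ I, a ≠ 0 ∧ ∀ x, x * a * a = 0 → x * a = 0 := by
  by_contra! hcon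
  -- A nonzero power of `c` with maximal annihilator would have the same annihilator as its square,
  -- contradicting `hcon`. So `I` is nil, and the rest derives a contradiction from a nonzero nil
  -- left ideal.
  have hnil : ∀ c ∈ I, ∃ n, succPow c n = 0 := by
    intro c hc
    obtain ⟨_, ⟨n, rfl⟩, hmin⟩ := hacc.has_min (Set.range (succPow c)) ⟨_, 0, rfl⟩
    refine ⟨n, ?_⟩
    by_contra hne
    obtain ⟨x, hx, hx'⟩ := hcon _ (hI.succPow_mem hc n) hne
    rw [mul_assoc, succPow_mul] at hx
    refine hmin _ ⟨n + n + 1, rfl⟩ (lt_of_le_of_ne (fun y hy => ?_) fun heq => hx' ?_)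
    · change y * succPow c (n + n + 1) = 0
      rw [← succPow_mul, ← mul_assoc, show y * succPow c n = 0 from hy, zero_mul]
    · change x ∈ (AddMonoidHom.mulRight (succPow c n)).ker
      rw [heq]
      exact hx
  obtain ⟨a, haI, ha0⟩ := I.bot_or_exists_ne_zero.resolve_left hI0
  have hex : ∃ y, a * y ≠ 0 := by
    by_contra! h
    exact ha0 (hs a fun r => by rw [h, zero_mul])
  -- For `b = a * y` with maximal annihilator and `c = b * x`, the last nonzero power of `c` lies in
  -- `b * A`, so it has the same left annihilator as `b`. Since `c` kills that power, `b * x * b =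
  -- 0`.
  obtain ⟨b, ⟨⟨y, rfl⟩, hb0⟩, hmin⟩ := hacc.has_min {b : A | (∃ y, b = a * y) ∧ b ≠ 0}
    (hex.elim fun y hy => ⟨_, ⟨y, rfl⟩, hy⟩)
  refine hb0 (hs _ fun x => ?_)
  by_cases hc0 : a * y * x = 0
  · rw [hc0, zero_mul]
  have hcnil : ∃ n, succPow (a * y * x) n = 0 := by
    obtain ⟨n, hn⟩ := hnil (y * x * a) (hI _ _ haI)
    refine ⟨n + 1, ?_⟩
    rw [succPow_succ', mul_assoc a y x, ← mul_assoc,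
      succPow_mul_comm, hn, mul_zero, zero_mul]
  classical
  obtain ⟨m, hm⟩ : ∃ m, Nat.find hcnil = m + 1 :=
    Nat.exists_eq_succ_of_ne_zero fun h0 => hc0 (by simpa [h0, succPow_zero] using Nat.find_spec hcnil)
  have hm1 : a * y * x * succPow (a * y * x) m = 0 := by
    rw [← succPow_succ, ← hm]
    exact Nat.find_spec hcnil
  have hm0 : succPow (a * y * x) m ≠ 0 := Nat.find_min hcnil (by omega)
  obtain ⟨w, hw⟩ : ∃ w, succPow (a * y * x) m = a * y * w := by
    cases m with
    | zero => exact ⟨x, rfl⟩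
    | succ m => exact ⟨x * succPow (a * y * x) m, by rw [succPow_succ, mul_assoc]⟩
  have hle : (AddMonoidHom.mulRight (a * y)).ker ≤
      (AddMonoidHom.mulRight (succPow (a * y * x) m)).ker := by
    intro z hz
    change z * _ = 0
    rw [hw, ← mul_assoc, show z * (a * y) = 0 from hz, zero_mul]
  have heq := hle.eq_of_not_lt (hmin _ ⟨⟨y * w, by rw [hw, mul_assoc]⟩, hm0⟩)
  change a * y * x ∈ (AddMonoidHom.mulRight (a * y)).ker
  rw [heq]
  exact hm1

/-- Goldie's theorem: essential left ideals of a semiprime left Goldie ring contain regular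
elements. -/
theorem exists_isRegular_mem (hfin : HasFiniteUDim (R := A) IsLeftIdeal) (hacc : HasElementACC A)
    {E : AddSubgroup A} (hE : IsLeftIdeal E) (hess : IsEssential IsLeftIdeal E) :
    ∃ c ∈ E, IsRegular c := by
  -- Start at `c = 0` and keep adding elements `a` of `E` that kill `c` from the left. Each step
  -- shrinks the left annihilator of `c` by at least `A * a`, so the process stops. The condition on
  -- `x * c * c` makes `x * (c + a) = 0` split into `x * c = 0` and `x * a = 0`.
  suffices h : ∀ N : AddSubgroup A, ∀ c ∈ E, (AddMonoidHom.mulRight c).ker = N →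
      (∀ x, x * c * c = 0 → x * c = 0) → ∃ c' ∈ E, ∀ x, x * c' = 0 → x = 0 by
    obtain ⟨c, hcE, hc⟩ := h _ 0 E.zero_mem rfl (by simp)
    exact ⟨c, hcE, isRegular_of_forall_mul_eq_zero hfin (hacc.isLeftNonsingular hs) hc⟩
  intro N
  induction N using hfin.wellFounded_down.induction with
  | _ N ih =>
  rintro c hcE rfl hc
  have hI : IsLeftIdeal ((AddMonoidHom.mulRight c).ker ⊓ E) :=
    isSumClosed_isLeftIdeal.inf (isLeftIdeal_ker_mulRight c) hE
  by_cases h0 : (AddMonoidHom.mulRight c).ker ⊓ E = ⊥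
  · refine ⟨c, hcE, fun x hx => (AddSubgroup.mem_bot).1 ?_⟩
    rw [← hess _ (isLeftIdeal_ker_mulRight c) (disjoint_iff.2 h0)]
    exact hx
  obtain ⟨a, ⟨hac, haE⟩, ha0, ha⟩ := hacc.exists_ker_mul_self hs hI h0
  have hac' : a * c = 0 := hac
  have hker : ∀ x, x * (c + a) = 0 → x * c = 0 ∧ x * a = 0 := by
    intro x hx
    have h1 : x * c = 0 := by
      refine hc x ?_
      have : x * (c + a) * c = 0 := by rw [hx, zero_mul]
      rwa [mul_add, add_mul, mul_assoc x a c, hac', mul_zero, add_zero] at this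
    refine ⟨h1, ?_⟩
    rwa [mul_add, h1, zero_add] at hx
  refine ih _ ⟨fun x hx => (hker x hx).1, (AddMonoidHom.mulRight a).range,
    isLeftIdeal_range_mulRight a, range_mulRight_ne_bot hs ha0, ?_, ?_⟩ (c + a)
    (E.add_mem hcE haE) rfl ?_
  · rintro _ ⟨y, rfl⟩
    change y * a * c = 0
    rw [mul_assoc, hac', mul_zero]
  · rw [AddSubgroup.disjoint_def]
    rintro _ ⟨y, rfl⟩ hy
    exact ha y (hker _ hy).2
  · intro x hx
    obtain ⟨h1, h2⟩ := hker _ hx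
    rw [mul_add, add_mul, mul_assoc x a c, hac', mul_zero, add_zero] at h1
    have h3 := hc x h1
    rw [mul_add, h3, zero_add] at h2
    rw [mul_add, h3, zero_add, ha x h2]

/-- The left Ore condition. -/
theorem exists_isRegular_mul_eq (hfin : HasFiniteUDim (R := A) IsLeftIdeal)
    (hacc : HasElementACC A) (r : A) {c : A} (hc : IsRegular c) :
    ∃ c' r', IsRegular c' ∧ c' * r = r' * c := by
  have hc' : ∀ x, x * c = 0 → x = 0 := fun x hx => hc.right (by simpa using hx)
  obtain ⟨c', ⟨r', hr'⟩, hreg⟩ := exists_isRegular_mem hs hfin hacc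
    ((isLeftIdeal_range_mulRight c).comap_mulRight r)
    ((isEssential_range_mulRight hfin hc').comap_mulRight r)
  exact ⟨c', r', hreg, hr'.symm⟩

end Goldie

/-! ### Ore localization of a ring without identity -/

section OreConstruction

variable {A : Type u} [NonUnitalRing A]

/-- The ring obtained from `A` by adjoining an identity element. -/
def IntUnitization (A : Type u) [NonUnitalRing A] : Type u := Unitization ℤ A

instance : Ring (IntUnitization A) := inferInstanceAs (Ring (Unitization ℤ A))

namespace IntUnitization

/-- The inclusion of `A` in its unitization. -/
def incl (A : Type u) [NonUnitalRing A] : A →ₙ+* IntUnitization A where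
  toFun := fun a => (a : Unitization ℤ A)
  map_mul' := fun a b => Unitization.inr_mul ℤ a b
  map_zero' := Unitization.inr_zero ℤ
  map_add' := fun a b => Unitization.inr_add ℤ a b

theorem incl_injective : Function.Injective (incl A) := Unitization.inr_injective

theorem exists_incl_mul (a : A) (u : IntUnitization A) : ∃ r : A, incl A a * u = incl A r := by
  have h : ∀ u : Unitization ℤ A, ∃ r : A, (a : Unitization ℤ A) * u = r := by
    intro u
    induction u using Unitization.ind with
    | inl_add_inr n b =>
      exact ⟨n • a + a * b, by
        rw [mul_add, Unitization.inr_mul_inl, ← Unitization.inr_mul, ← Unitization.inr_add]⟩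
  exact h u

/-- The submonoid of the unitization that consists of `1` and the regular elements of `A`. -/
def regularSubmonoid (A : Type u) [NonUnitalRing A] : Submonoid (IntUnitization A) where
  carrier := {u | u = 1 ∨ ∃ c : A, IsRegular c ∧ u = incl A c}
  one_mem' := Or.inl rfl
  mul_mem' := by
    rintro _ _ (rfl | ⟨c, hc, rfl⟩) (rfl | ⟨d, hd, rfl⟩)
    · left; simp
    · right; exact ⟨d, hd, by simp⟩
    · right; exact ⟨c, hc, by simp⟩
    · right; exact ⟨c * d, hc.mul hd, by simp⟩

theorem incl_mem_regularSubmonoid {c : A} (hc : IsRegular c) : incl A c ∈ regularSubmonoid A :=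
  Or.inr ⟨c, hc, rfl⟩

/-- Multiplying by one fixed regular element absorbs the denominator `1`, which need not lie in `A`.
-/
theorem exists_incl_eq_incl_mul {d : A} (hd : IsRegular d) (s : regularSubmonoid A) :
    ∃ c : A, IsRegular c ∧ incl A c = incl A d * s := by
  obtain ⟨_, rfl | ⟨c, hc, rfl⟩⟩ := s
  · exact ⟨d, hd, by simp⟩
  · exact ⟨d * c, hd.mul hc, by simp⟩

variable (hore : ∀ r c : A, IsRegular c → ∃ c' r', IsRegular c' ∧ c' * r = r' * c)

include hore in
theorem exists_ore (u : IntUnitization A) (s : regularSubmonoid A) :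
    ∃ (n : IntUnitization A) (d : regularSubmonoid A), d * u = n * s := by
  obtain ⟨_, rfl | ⟨c, hc, rfl⟩⟩ := s
  · exact ⟨u, 1, by simp⟩
  · obtain ⟨r, hr⟩ := exists_incl_mul c u
    obtain ⟨c', r', hc', h⟩ := hore r c hc
    -- The factor `c` first moves `u` into `A`, where the Ore condition applies: `c' * (c * u) = r'
    -- * c`.
    refine ⟨incl A r', ⟨_, incl_mem_regularSubmonoid hc'⟩ * ⟨_, incl_mem_regularSubmonoid hc⟩, ?_⟩
    rw [Submonoid.coe_mul, mul_assoc]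
    dsimp only
    rw [hr, ← map_mul, h, map_mul]

/-- The regular elements of a ring with the left Ore condition form an Ore set. -/
@[reducible]
noncomputable def oreSet : OreLocalization.OreSet (regularSubmonoid A) where
  ore_right_cancel := by
    rintro r₁ r₂ ⟨_, rfl | ⟨c, hc, rfl⟩⟩ h
    · exact ⟨1, by simpa using h⟩
    · refine ⟨⟨_, incl_mem_regularSubmonoid hc⟩, ?_⟩
      obtain ⟨a, ha⟩ := exists_incl_mul c r₁
      obtain ⟨b, hb⟩ := exists_incl_mul c r₂
      have h1 : incl A c * r₁ * incl A c = incl A c * r₂ * incl A c := by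
        rw [mul_assoc, mul_assoc]
        exact congrArg _ h
      dsimp only
      rw [ha, hb, ← map_mul, ← map_mul] at h1
      rw [ha, hb, hc.right (incl_injective h1)]
  oreNum u s := (exists_ore hore u s).choose
  oreDenom u s := (exists_ore hore u s).choose_spec.choose
  ore_eq u s := (exists_ore hore u s).choose_spec.choose_spec

end IntUnitization

open IntUnitization OreLocalization in
/-- A ring with a regular element and the left Ore condition has a classical left quotient
ring. -/
theorem exists_isLeftQuotientRing
    (hore : ∀ r c : A, IsRegular c → ∃ c' r', IsRegular c' ∧ c' * r = r' * c)
    (hne : ∃ d : A, IsRegular d) :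
    ∃ (Q : Type u) (_ : Ring Q) (f : A →ₙ+* Q), IsLeftQuotientRing f := by
  let _ := oreSet hore
  obtain ⟨d, hd⟩ := hne
  refine ⟨OreLocalization (regularSubmonoid A) (IntUnitization A), inferInstance,
    (numeratorRingHom : IntUnitization A →+* _).toNonUnitalRingHom.comp (incl A), ?_, ?_, ?_⟩
  · exact fun c hc => numerator_isUnit ⟨_, incl_mem_regularSubmonoid hc⟩
  · intro q
    induction q using OreLocalization.ind with
    | _ u s =>
      obtain ⟨c, hc, hcs⟩ := exists_incl_eq_incl_mul hd s
      obtain ⟨r, hr⟩ := exists_incl_mul d u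
      refine ⟨c, hc, r, ?_⟩
      change numeratorHom (incl A c) * _ = numeratorHom (incl A r)
      rw [hcs, map_mul, mul_assoc, numeratorHom_apply (r := (s : IntUnitization A)),
        OreLocalization.mul_cancel, ← numeratorHom_apply, ← map_mul, hr]
  · intro r
    change incl A r /ₒ (1 : regularSubmonoid A) = 0 ↔ _
    rw [OreLocalization.zero_def, oreDiv_eq_iff]
    constructor
    · rintro ⟨s, t, h1, h2⟩
      obtain ⟨c, hc, hcs⟩ := exists_incl_eq_incl_mul hd s
      refine ⟨c, hc, incl_injective ?_⟩
      simp only [OneMemClass.coe_one, mul_one, smul_zero, smul_eq_mul] at h1 h2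
      rw [map_mul, hcs, mul_assoc, h2, ← h1, mul_zero, map_zero]
    · rintro ⟨c, hc, h⟩
      refine ⟨⟨_, incl_mem_regularSubmonoid hc⟩, incl A c, ?_, by simp⟩
      rw [smul_zero, smul_eq_mul, ← map_mul, h, map_zero]

end OreConstruction

/-! ### Universal property of left fractions -/

section Lift

variable {R : Type*} [NonUnitalRing R] {Q Q' : Type*} [Ring Q] [Ring Q'] {S : Set R}
  {f : R →ₙ+* Q}

namespace IsLeftFractionRing

theorem injective (hf : IsLeftFractionRing S f) (hS : S ⊆ regularElements R) :
    Function.Injective f := by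
  rw [injective_iff_map_eq_zero]
  intro r hr
  obtain ⟨s, hs, h⟩ := (hf.map_eq_zero_iff r).1 hr
  exact (hS hs).left (by simpa using h)

variable (hf : IsLeftFractionRing S f)

include hf

/-- Two left fractions can be brought to a common denominator. -/
theorem exists_common_denominator {s t : R} (ht : t ∈ S) :
    ∃ u ∈ S, ∃ w, f (u * s) = f (w * t) := by
  obtain ⟨x, hx⟩ := hf.isUnit_map t ht
  obtain ⟨u, hu, w, h⟩ := hf.exists_fraction (f s * ↑x⁻¹)
  refine ⟨u, hu, w, ?_⟩
  rw [map_mul, map_mul, ← h, ← hx, mul_assoc, mul_assoc, Units.inv_mul, mul_one]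

theorem ringHom_ext {Φ Ψ : Q →+* Q'} (h : ∀ r, Φ (f r) = Ψ (f r)) : Φ = Ψ := by
  ext q
  obtain ⟨s, hs, r, hq⟩ := hf.exists_fraction q
  refine ((hf.isUnit_map s hs).map Φ).mul_left_cancel ?_
  rw [← map_mul, hq, h s, ← map_mul, hq, h r]

theorem map_eq_of_map_eq {φ : R →ₙ+* Q'} (hφ : ∀ s ∈ S, IsUnit (φ s)) {a b : R}
    (h : f a = f b) : φ a = φ b := by
  rw [← sub_eq_zero, ← map_sub, hf.map_eq_zero_iff] at h
  obtain ⟨s, hs, h⟩ := h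
  rw [← sub_eq_zero, ← map_sub]
  refine (hφ s hs).mul_left_cancel ?_
  rw [← map_mul, h, map_zero, mul_zero]

theorem exists_lift (hS : ∀ {s t}, s ∈ S → t ∈ S → s * t ∈ S) (φ : R →ₙ+* Q') (hφ : ∀ s ∈ S, IsUnit (φ s)) :
    ∃ Φ : Q →+* Q', ∀ r, Φ (f r) = φ r := by
  -- The value `q'` works for all representations of `q` at once, which gives well-definedness.
  have hex : ∀ q, ∃ q', ∀ s ∈ S, ∀ r, f s * q = f r → φ s * q' = φ r := by
    intro q
    obtain ⟨t, ht, b, htb⟩ := hf.exists_fraction q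
    obtain ⟨x, hx⟩ := hφ t ht
    refine ⟨↑x⁻¹ * φ b, fun s hs a hsa => ?_⟩
    obtain ⟨u, hu, w, huw⟩ := hf.exists_common_denominator (s := s) ht
    refine (hφ u hu).mul_left_cancel ?_
    rw [← mul_assoc, ← map_mul, hf.map_eq_of_map_eq hφ huw, map_mul, ← hx, mul_assoc,
      Units.mul_inv_cancel_left, ← map_mul, ← map_mul]
    refine hf.map_eq_of_map_eq hφ ?_
    rw [map_mul, map_mul, ← htb, ← hsa, ← mul_assoc, ← mul_assoc, ← map_mul, ← map_mul, huw]
  choose Φ hΦ using hex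
  have huniq : ∀ {q q'} {s r : R}, s ∈ S → f s * q = f r → φ s * q' = φ r → Φ q = q' :=
    fun hs h h' => (hφ _ hs).mul_left_cancel ((hΦ _ _ hs _ h).trans h'.symm)
  obtain ⟨s₀, hs₀, -⟩ := hf.exists_fraction 0
  refine ⟨{ toFun := Φ, map_one' := ?_, map_zero' := ?_, map_mul' := ?_, map_add' := ?_ }, ?_⟩
  · exact huniq hs₀ (mul_one _) (mul_one _)
  · intro p q
    obtain ⟨s, hs, a, hp⟩ := hf.exists_fraction p
    obtain ⟨t, ht, b, hq⟩ := hf.exists_fraction q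
    obtain ⟨u, hu, w, huw⟩ := hf.exists_common_denominator (s := a) ht
    have h1 : f (u * s) * (p * q) = f (w * b) := by
      rw [← mul_assoc, map_mul, mul_assoc (f u), hp, ← map_mul, huw, map_mul, mul_assoc, hq,
        ← map_mul]
    have h2 : φ (u * s) * (Φ p * Φ q) = φ (w * b) := by
      rw [← mul_assoc, map_mul, mul_assoc (φ u), hΦ p s hs a hp, ← map_mul,
        hf.map_eq_of_map_eq hφ huw, map_mul, mul_assoc, hΦ q t ht b hq, ← map_mul]
    exact huniq (hS hu hs) h1 h2
  · exact huniq hs₀ (r := 0) (by simp) (by simp)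
  · intro p q
    obtain ⟨s, hs, a, hp⟩ := hf.exists_fraction p
    obtain ⟨t, ht, b, hq⟩ := hf.exists_fraction q
    obtain ⟨u, hu, w, huw⟩ := hf.exists_common_denominator (s := s) ht
    refine huniq (hS hu hs) (r := u * a + w * b) ?_ ?_
    · rw [mul_add, map_add, map_mul f u a, ← hp, ← mul_assoc, ← map_mul, huw, map_mul f w b, ← hq,
        ← mul_assoc, ← map_mul]
    · rw [mul_add, map_add, map_mul φ u a, ← hΦ p s hs a hp, ← mul_assoc, ← map_mul,
        hf.map_eq_of_map_eq hφ huw, map_mul φ w b, ← hΦ q t ht b hq, ← mul_assoc, ← map_mul]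
  · exact fun r => huniq hs₀ (map_mul f _ _).symm (map_mul φ _ _).symm

end IsLeftFractionRing
end Lift

/-! ### Transfer between a ring and its fixed ring -/

section FixedRing

variable {R S : Type*} [NonUnitalRing R] [NonUnitalRing S] {Γ : Type*} [Group Γ]

/-- The embedding `ι` identifies `S` with the ring of invariants of the action `α` on `R`. -/
structure IsFixedRing (α : Γ →* RingAut R) (ι : S →ₙ+* R) : Prop where
  injective : Function.Injective ι
  apply_map : ∀ g s, α g (ι s) = ι s
  exists_map_eq : ∀ r, (∀ g, α g r = r) → ∃ s, ι s = r

variable {α : Γ →* RingAut R} {ι : S →ₙ+* R}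

/-- The largest invariant additive subgroup contained in `X`. -/
def invariantCore (α : Γ →* RingAut R) (X : AddSubgroup R) : AddSubgroup R where
  carrier := {x | ∀ g, α g x ∈ X}
  zero_mem' := fun g => by rw [map_zero]; exact X.zero_mem
  add_mem' := fun ha hb g => by rw [map_add]; exact X.add_mem (ha g) (hb g)
  neg_mem' := fun ha g => by rw [map_neg]; exact X.neg_mem (ha g)

theorem invariantCore_le (X : AddSubgroup R) : invariantCore α X ≤ X := fun x hx => by
  simpa using hx 1

theorem apply_mem_invariantCore (X : AddSubgroup R) (g : Γ) {x : R} (hx : x ∈ invariantCore α X) :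
    α g x ∈ invariantCore α X := fun h => by
  simpa [map_mul] using hx (h * g)

theorem IsLeftIdeal.invariantCore {X : AddSubgroup R} (hX : IsLeftIdeal X) :
    IsLeftIdeal (invariantCore α X) := fun r x hx g => by
  rw [map_mul]
  exact hX _ _ (hx g)

theorem IsLeftIdeal.comap_apply {X : AddSubgroup R} (hX : IsLeftIdeal X) (g : Γ) :
    IsLeftIdeal (X.comap (α g : R →+ R)) := fun r x hx => by
  change α g (r * x) ∈ X
  rw [map_mul]
  exact hX _ _ hx

theorem invariantCore_comap_apply (X : AddSubgroup R) (g : Γ) :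
    invariantCore α (X.comap (α g : R →+ R)) = invariantCore α X := by
  ext x
  constructor
  · intro h k
    have : α g (α (g⁻¹ * k) x) ∈ X := h (g⁻¹ * k)
    simpa [map_mul] using this
  · intro h k
    change α g (α k x) ∈ X
    simpa [map_mul] using h (g * k)

theorem inv_apply_apply (g : Γ) (y : R) : α g⁻¹ (α g y) = y := by
  rw [← RingAut.mul_apply, ← map_mul, inv_mul_cancel, map_one, RingAut.one_apply]

theorem apply_inv_apply (g : Γ) (y : R) : α g (α g⁻¹ y) = y := by
  rw [← RingAut.mul_apply, ← map_mul, mul_inv_cancel, map_one, RingAut.one_apply]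

theorem IsEssential.comap_apply {E : AddSubgroup R} (hE : IsEssential IsLeftIdeal E) (g : Γ) :
    IsEssential IsLeftIdeal (E.comap (α g : R →+ R)) := by
  intro I hI hd
  have h0 : I.comap (α g⁻¹ : R →+ R) = ⊥ := by
    refine hE _ (hI.comap_apply g⁻¹) (AddSubgroup.disjoint_def.2 fun {y} hy hyE => ?_)
    have : α g⁻¹ y = 0 := AddSubgroup.disjoint_def.1 hd hy (by
      change α g (α g⁻¹ y) ∈ E
      rwa [apply_inv_apply])
    rw [← apply_inv_apply (α := α) g y, this, map_zero]
  rw [eq_bot_iff]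
  intro y hy
  have hmem : α g y ∈ I.comap (α g⁻¹ : R →+ R) := by
    change α g⁻¹ (α g y) ∈ I
    rwa [inv_apply_apply]
  rw [h0, AddSubgroup.mem_bot] at hmem
  rw [AddSubgroup.mem_bot, ← inv_apply_apply (α := α) g y, hmem, map_zero]

theorem exists_maximal_invariantCore_eq_bot [Finite Γ] (α : Γ →* RingAut R) :
    ∃ x : AddSubgroup R, IsLeftIdeal x ∧ invariantCore α x = ⊥ ∧
      ∀ Y, IsLeftIdeal Y → x < Y → invariantCore α Y ≠ ⊥ := by
  obtain ⟨x, hx⟩ := zorn_le₀ {x : AddSubgroup R | IsLeftIdeal x ∧ invariantCore α x = ⊥} (by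
    intro c hc hchain
    refine ⟨sSup c, ⟨isSumClosed_isLeftIdeal.sSup fun A hA => (hc hA).1, ?_⟩,
      fun z hz => le_sSup hz⟩
    rw [eq_bot_iff]
    intro r hr
    rcases c.eq_empty_or_nonempty with rfl | hne
    · have := hr 1
      simpa using this
    -- The orbit of `r` is finite, so a single member of the chain contains all of it.
    have hex : ∀ g, ∃ A : c, α g r ∈ A.1 := fun g => by
      obtain ⟨A, hA, h⟩ := (AddSubgroup.mem_sSup_of_directedOn hne hchain.directedOn).1 (hr g)
      exact ⟨⟨A, hA⟩, h⟩
    choose A hA using hex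
    have : Nonempty c := hne.to_subtype
    obtain ⟨B, hB⟩ := hchain.directedOn.directed_val.finite_le A
    rw [← (hc B.2).2]
    exact fun g => hB g (hA g))
  exact ⟨x, hx.1.1, hx.1.2, fun Y hY hlt hYc => hlt.not_ge (hx.2 ⟨hY, hYc⟩ hlt.le)⟩

theorem IsLeftIdeal.comap_map {J : AddSubgroup R} (hJ : IsLeftIdeal J) (ι : S →ₙ+* R) :
    IsLeftIdeal (J.comap (ι : S →+ R)) := fun r x hx => by
  change ι (r * x) ∈ J
  rw [map_mul]
  exact hJ _ _ hx

/-- The left ideal `R · I` of `R` generated by a subgroup of `S`. -/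
def extendIdeal (ι : S →ₙ+* R) (I : AddSubgroup S) : AddSubgroup R :=
  AddSubgroup.closure {x | ∃ r, ∃ s ∈ I, x = r * ι s}

theorem isLeftIdeal_extendIdeal (I : AddSubgroup S) : IsLeftIdeal (extendIdeal ι I) := by
  intro r x hx
  have : extendIdeal ι I ≤ (extendIdeal ι I).comap (AddMonoidHom.mulLeft r) := by
    refine (AddSubgroup.closure_le _).2 ?_
    rintro _ ⟨t, s, hs, rfl⟩
    exact AddSubgroup.subset_closure ⟨r * t, s, hs, (mul_assoc _ _ _).symm⟩
  exact this hx

theorem extendIdeal_mono {I K : AddSubgroup S} (h : I ≤ K) : extendIdeal ι I ≤ extendIdeal ι K :=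
  AddSubgroup.closure_mono fun _ ⟨r, s, hs, hx⟩ => ⟨r, s, h hs, hx⟩

theorem extendIdeal_ne_bot (hR : ∀ a : R, (∀ r, a * r * a = 0) → a = 0)
    (hι : Function.Injective ι) {I : AddSubgroup S} (hI : I ≠ ⊥) : extendIdeal ι I ≠ ⊥ := by
  obtain ⟨s, hs, hs0⟩ := I.bot_or_exists_ne_zero.resolve_left hI
  intro h
  refine hs0 (hι ((hR _ fun r => ?_).trans (map_zero ι).symm))
  have : r * ι s = 0 := (AddSubgroup.mem_bot).1 (h ▸ AddSubgroup.subset_closure ⟨r, s, hs, rfl⟩)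
  rw [mul_assoc, this, mul_zero]

namespace IsFixedRing

variable (hS : IsFixedRing α ι)

include hS

theorem apply_mem_extendIdeal (I : AddSubgroup S) (g : Γ) {x : R} (hx : x ∈ extendIdeal ι I) :
    α g x ∈ extendIdeal ι I := by
  have : extendIdeal ι I ≤ (extendIdeal ι I).comap (α g : R →+ R) := by
    refine (AddSubgroup.closure_le _).2 ?_
    rintro _ ⟨t, s, hs, rfl⟩
    exact AddSubgroup.subset_closure ⟨α g t, s, hs, by
      change α g (t * ι s) = _
      rw [map_mul, hS.apply_map]⟩
  exact this hx

/-- The annihilator condition passes to the ring of invariants. -/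
theorem isLeftGoldie_of_hasFiniteUDim (hG : IsLeftGoldie R)
    (hfin : HasFiniteUDim (R := S) IsLeftIdeal) : IsLeftGoldie S := by
  refine ⟨hfin, fun X hX hmono => ?_⟩
  -- Replacing `X n` by the right annihilator of its left annihilator changes no annihilator in `S`
  -- and makes the left annihilators in `R` increase with `n`.
  let Y : ℕ → Set R := fun n => {y | ∃ x, y = ι x ∧ ∀ s ∈ leftAnn (X n), s * x = 0}
  have hY : ∀ n s, s ∈ leftAnn (X n) ↔ ι s ∈ leftAnn (Y n) := by
    intro n s
    constructor
    · rintro hs _ ⟨x, rfl, hx⟩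
      rw [← map_mul, hx s hs, map_zero]
    · intro hs x hx
      refine hS.injective ?_
      rw [map_mul, map_zero]
      exact hs _ ⟨x, rfl, fun t ht => ht x hx⟩
  obtain ⟨N, hN⟩ := hG.2 Y (fun n => ⟨0, 0, (map_zero ι).symm, fun s _ => mul_zero s⟩) (by
    intro m n hmn r hr
    rintro _ ⟨x, rfl, hx⟩
    exact hr _ ⟨x, rfl, fun s hs => hx s (hmono hmn hs)⟩)
  refine ⟨N, fun n hn => ?_⟩
  ext s
  rw [hY, hN n hn, ← hY]

variable [Fintype Γ]

theorem exists_map_eq_trace (r : R) : ∃ s, ι s = trace α r :=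
  hS.exists_map_eq _ fun g => apply_trace g r

theorem exists_mem_map_eq_trace {I : AddSubgroup S} (hI : IsLeftIdeal I) {x : R}
    (hx : x ∈ extendIdeal ι I) : ∃ s ∈ I, ι s = trace α x := by
  induction hx using AddSubgroup.closure_induction with
  | mem x hx =>
    obtain ⟨r, s, hs, rfl⟩ := hx
    obtain ⟨t, ht⟩ := hS.exists_map_eq_trace r
    refine ⟨t * s, hI t s hs, ?_⟩
    rw [map_mul, ht, trace_mul_right fun g => hS.apply_map g s]
  | zero => exact ⟨0, I.zero_mem, by simp [trace]⟩
  | add x y _ _ hx hy =>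
    obtain ⟨s, hs, hsx⟩ := hx
    obtain ⟨t, ht, hty⟩ := hy
    exact ⟨s + t, I.add_mem hs ht, by simp [trace, hsx, hty, Finset.sum_add_distrib]⟩
  | neg x _ hx =>
    obtain ⟨s, hs, hsx⟩ := hx
    exact ⟨-s, I.neg_mem hs, by simp [trace, hsx]⟩

variable (hR : ∀ a : R, (∀ r, a * r * a = 0) → a = 0)
  (htf : ∀ x : R, Fintype.card Γ • x = 0 → x = 0)

include hR htf

/-- Traces of elements of `J` are fixed elements of `J`, hence zero, and Bergman–Isaacs applies. -/
theorem eq_bot_of_comap_eq_zero {J : AddSubgroup R} (hJ : IsLeftIdeal J)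
    (hJG : ∀ g, ∀ x ∈ J, α g x ∈ J) (h : ∀ s, ι s ∈ J → s = 0) : J = ⊥ := by
  refine eq_bot_of_mul_trace_eq_zero hR hJ hJG (fun x _ => htf x) fun x _ y hy => ?_
  obtain ⟨s, hs⟩ := hS.exists_map_eq_trace y
  rw [← hs, h s (by rw [hs]; exact trace_mem hJG hy), map_zero, mul_zero]

/-- Bergman–Isaacs applies to `R * a`, since `R * a * trace (R * a) = R * (a * trace R * a) = 0`. -/
theorem semiprime (a : S) (ha : ∀ s, a * s * a = 0) : a = 0 := by
  have hJ : (AddMonoidHom.mulRight (ι a)).range = ⊥ := by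
    refine eq_bot_of_mul_trace_eq_zero (α := α) hR (isLeftIdeal_range_mulRight _) ?_
      (fun x _ => htf x) ?_
    · rintro g _ ⟨r, rfl⟩
      refine ⟨α g r, ?_⟩
      change α g r * ι a = α g (r * ι a)
      rw [map_mul, hS.apply_map]
    · rintro _ ⟨r, rfl⟩ _ ⟨t, rfl⟩
      change r * ι a * trace α (t * ι a) = 0
      obtain ⟨s, hs⟩ := hS.exists_map_eq_trace t
      rw [trace_mul_right fun g => hS.apply_map g a, ← hs, mul_assoc, ← mul_assoc (ι a), ← map_mul,
        ← map_mul, ha, map_zero, mul_zero]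
  by_contra h0
  exact range_mulRight_ne_bot hR (fun h => h0 (hS.injective (h.trans (map_zero ι).symm))) hJ

/-- The intersection is invariant, and its traces lie in `I` and come from `J`. Phrasing `hd`
through traces covers both `J = R * K`, whose traces lie in `K`, and an arbitrary invariant `J`,
whose traces lie in `J`. -/
theorem disjoint_extendIdeal {I : AddSubgroup S} (hI : IsLeftIdeal I) {J : AddSubgroup R}
    (hJ : IsLeftIdeal J) (hJG : ∀ g, ∀ x ∈ J, α g x ∈ J)
    (hd : ∀ s ∈ I, (∃ y ∈ J, ι s = trace α y) → s = 0) : Disjoint (extendIdeal ι I) J := by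
  rw [disjoint_iff]
  have hG : ∀ g, ∀ x ∈ extendIdeal ι I ⊓ J, α g x ∈ extendIdeal ι I ⊓ J := fun g x hx =>
    ⟨hS.apply_mem_extendIdeal I g hx.1, hJG g x hx.2⟩
  refine eq_bot_of_mul_trace_eq_zero hR (isSumClosed_isLeftIdeal.inf (isLeftIdeal_extendIdeal I) hJ)
    hG (fun x _ => htf x) fun x _ y hy => ?_
  obtain ⟨s, hs, hsy⟩ := hS.exists_mem_map_eq_trace hI hy.1
  rw [← hsy, hd s hs ⟨y, hy.2, hsy⟩, map_zero, mul_zero]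

theorem isDirectFamily_extendIdeal {κ : Type*} {I : κ → AddSubgroup S}
    (hI : IsDirectFamily IsLeftIdeal I) :
    IsDirectFamily IsLeftIdeal fun i => extendIdeal ι (I i) := by
  refine ⟨fun i => ⟨isLeftIdeal_extendIdeal _, extendIdeal_ne_bot hR hS.injective (hI.1 i).2⟩,
    fun i => ?_⟩
  have hK : IsLeftIdeal (⨆ (j) (_ : j ≠ i), I j) :=
    isSumClosed_isLeftIdeal.iSup fun j => isSumClosed_isLeftIdeal.iSup fun _ => (hI.1 j).1
  refine Disjoint.mono_right (iSup₂_le fun j hj => 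
      extendIdeal_mono (le_iSup₂ (f := fun j (_ : j ≠ i) => I j) j hj))
    (hS.disjoint_extendIdeal hR htf (hI.1 i).1 (isLeftIdeal_extendIdeal _)
      (fun g x => hS.apply_mem_extendIdeal _ g) ?_)
  rintro s hs ⟨y, hy, hsy⟩
  obtain ⟨t, ht, hty⟩ := hS.exists_mem_map_eq_trace hK hy
  rw [← hsy] at hty
  exact AddSubgroup.disjoint_def.1 (hI.2 i) hs (hS.injective hty ▸ ht)

theorem hasFiniteUDim_of_ring (h : HasFiniteUDim (R := R) IsLeftIdeal) :
    HasFiniteUDim (R := S) IsLeftIdeal := fun ⟨_, hI⟩ =>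
  h ⟨_, hS.isDirectFamily_extendIdeal hR htf hI⟩

theorem uDim_le : uDim (R := S) IsLeftIdeal ≤ uDim (R := R) IsLeftIdeal :=
  iSup₂_le fun n ⟨_, hI⟩ => le_iSup₂ (f := fun (n : ℕ) _ => (n : ℕ∞)) n
    ⟨_, hS.isDirectFamily_extendIdeal hR htf hI⟩

/-- Each `x ⊔ A i` is strictly larger than `x`, so its invariant core is nonzero and contains
nonzero fixed elements. The resulting left ideals of `S` are independent: a fixed element common to
one and the sum of others lies in `x`, hence in its zero core. -/
theorem directBound_of_maximal {k : ℕ} (hk : DirectBound (M := S) IsLeftIdeal ⊥ k)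
    {x : AddSubgroup R} (hx : IsLeftIdeal x) (hcore : invariantCore α x = ⊥)
    (hmax : ∀ Y, IsLeftIdeal Y → x < Y → invariantCore α Y ≠ ⊥) :
    DirectBound IsLeftIdeal x k := by
  intro κ s A hA hs hd
  refine hk κ s (fun i => (invariantCore α (x ⊔ A i)).comap (ι : S →+ R)) (fun i hi => ?_) ?_
    disjoint_bot_right
  · have hxA := isSumClosed_isLeftIdeal.sup hx (hA i hi).1
    refine ⟨hxA.invariantCore.comap_map ι, fun hbot => hmax _ hxA ?_ ?_⟩
    · refine lt_of_le_of_ne le_sup_left fun heq => (hA i hi).2 ?_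
      have hdi := hd.mono_left (Finset.le_sup (f := A) hi)
      exact disjoint_self.1 (hdi.mono_right (by rw [heq]; exact le_sup_right))
    · exact hS.eq_bot_of_comap_eq_zero hR htf hxA.invariantCore
        (fun g y => apply_mem_invariantCore _ g)
        fun t ht => (AddSubgroup.mem_bot).1 (hbot ▸ (show t ∈ AddSubgroup.comap _ _ from ht))
  · intro t ht i hi hit
    rw [AddSubgroup.disjoint_def]
    intro y hyi hyt
    have hle : t.sup (fun i => (invariantCore α (x ⊔ A i)).comap (ι : S →+ R)) ≤
        (x ⊔ t.sup A).comap (ι : S →+ R) :=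
      Finset.sup_le fun j hj => AddSubgroup.comap_mono
        ((invariantCore_le _).trans (sup_le_sup_left (Finset.le_sup (f := A) hj) x))
    have hdis : Disjoint (A i) (x ⊔ t.sup A) := by
      rw [sup_comm]
      refine (hs ht hi hit).disjoint_sup_right_of_disjoint_sup_left (hd.mono_left ?_)
      exact sup_le (Finset.le_sup (f := A) hi) (Finset.sup_mono ht)
    have hyx : ι y ∈ x := by
      rw [← sup_inf_sup_eq_of_disjoint hdis]
      exact ⟨invariantCore_le _ hyi, hle hyt⟩
    refine hS.injective (((AddSubgroup.mem_bot).1 (hcore ▸ fun g => ?_)).trans (map_zero ι).symm)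
    rw [hS.apply_map]
    exact hyx

/-- Every conjugate of a maximal core-free left ideal is again maximal core-free and has bound `k`.
Their intersection is the core, which is zero. -/
theorem directBound_bot {k : ℕ} (hk : DirectBound (M := S) IsLeftIdeal ⊥ k) :
    DirectBound (M := R) IsLeftIdeal ⊥ (Fintype.card Γ * k) := by
  obtain ⟨x, hx, hcore, hmax⟩ := exists_maximal_invariantCore_eq_bot α
  have hconj : ∀ g, DirectBound IsLeftIdeal (x.comap (α g : R →+ R)) k := by
    intro g
    refine hS.directBound_of_maximal hR htf hk (hx.comap_apply g)
      (by rw [invariantCore_comap_apply, hcore]) fun Y hY hlt => ?_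
    rw [← invariantCore_comap_apply Y g⁻¹]
    refine hmax _ (hY.comap_apply _) (lt_of_le_of_ne (fun y hy => hlt.le ?_) fun heq => ?_)
    · change α g (α g⁻¹ y) ∈ x
      rwa [apply_inv_apply]
    · refine hlt.not_ge fun y hy => ?_
      change α g y ∈ x
      rw [heq]
      change α g⁻¹ (α g y) ∈ Y
      rwa [inv_apply_apply]
  have := DirectBound.finset_inf isSumClosed_isLeftIdeal (fun g => hx.comap_apply (α := α) g) hconj
    Finset.univ
  have hbot : Finset.univ.inf (fun g => x.comap (α g : R →+ R)) = ⊥ := by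
    rw [eq_bot_iff, ← hcore]
    exact fun y hy g => (Finset.inf_le (f := fun g => x.comap (α g : R →+ R))
      (Finset.mem_univ g)) hy
  rwa [hbot, Finset.card_univ] at this

theorem uDim_ring_le (h : HasFiniteUDim (R := S) IsLeftIdeal) :
    uDim (R := R) IsLeftIdeal ≤ Fintype.card Γ * uDim (R := S) IsLeftIdeal := by
  obtain ⟨k, hk⟩ := ENat.ne_top_iff_exists.1 (h.uDim_lt_top isSumClosed_isLeftIdeal).ne
  rw [← hk, ← Nat.cast_mul, uDim_le_iff]
  exact hS.directBound_bot hR htf (uDim_le_iff.1 hk.ge)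

theorem hasFiniteUDim_iff : HasFiniteUDim (R := R) IsLeftIdeal ↔
    HasFiniteUDim (R := S) IsLeftIdeal := by
  refine ⟨hS.hasFiniteUDim_of_ring hR htf, fun h => hasFiniteUDim_of_uDim_lt_top ?_⟩
  obtain ⟨k, hk⟩ := h.exists_directBound isSumClosed_isLeftIdeal ⊥ isSumClosed_isLeftIdeal.bot
  exact (uDim_le_iff.2 (hS.directBound_bot hR htf hk)).trans_lt (ENat.natCast_lt_top _)

theorem isEssential_comap {E : AddSubgroup R} (hE : IsLeftIdeal E)
    (hEG : ∀ g, ∀ x ∈ E, α g x ∈ E) (hess : IsEssential IsLeftIdeal E) :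
    IsEssential IsLeftIdeal (E.comap (ι : S →+ R)) := by
  intro I hI hd
  by_contra h0
  refine extendIdeal_ne_bot hR hS.injective h0 (hess _ (isLeftIdeal_extendIdeal I)
    (hS.disjoint_extendIdeal hR htf hI hE hEG ?_))
  rintro s hs ⟨y, hy, hsy⟩
  refine AddSubgroup.disjoint_def.1 hd hs ?_
  change ι s ∈ E
  rw [hsy]
  exact trace_mem hEG hy

theorem isLeftNonsingular (h : IsLeftNonsingular S) : IsLeftNonsingular R := by
  let Z : AddSubgroup R :=
    { carrier := {z | IsEssential IsLeftIdeal (AddMonoidHom.mulRight z).ker}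
      zero_mem' := fun X _ hd => by
        rw [eq_bot_iff]
        exact fun y hy => AddSubgroup.disjoint_def.1 hd hy (mul_zero y)
      add_mem' := fun {a b} ha hb => by
        refine (ha.inf isSumClosed_isLeftIdeal hb (isLeftIdeal_ker_mulRight a)).mono
          fun y hy => ?_
        change y * (a + b) = 0
        rw [mul_add, show y * a = 0 from hy.1, show y * b = 0 from hy.2, add_zero]
      neg_mem' := fun {a} ha => by
        refine ha.mono fun y hy => ?_
        change y * -a = 0
        rw [mul_neg, show y * a = 0 from hy, neg_zero] }
  -- The singular ideal is an invariant left ideal, and its fixed elements are singular in `S`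
  -- because essential invariant left ideals restrict to essential ones.
  have hZ : Z = ⊥ := by
    refine hS.eq_bot_of_comap_eq_zero hR htf (fun r z hz => ?_) (fun g z hz => ?_)
      fun s hs => ?_
    · refine (IsEssential.comap_mulRight hz r).mono fun y hy => ?_
      change y * (r * z) = 0
      rw [← mul_assoc]
      exact hy
    · refine (IsEssential.comap_apply (α := α) hz g⁻¹).mono fun y hy => ?_
      change y * α g z = 0
      rw [← apply_inv_apply (α := α) g y, ← map_mul, show α g⁻¹ y * z = 0 from hy, map_zero]
    · refine h s ((hS.isEssential_comap hR htf (isLeftIdeal_ker_mulRight (ι s)) ?_ hs).mono ?_)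
      · intro g x hx
        change α g x * ι s = 0
        rw [← hS.apply_map g s, ← map_mul, show x * ι s = 0 from hx, map_zero]
      · intro t ht
        refine hS.injective ?_
        change ι (t * s) = ι 0
        rw [map_mul, map_zero]
        exact ht
  exact fun z hz => (AddSubgroup.mem_bot).1 (hZ ▸ (show z ∈ Z from hz))

theorem isLeftGoldie_iff : IsLeftGoldie R ↔ IsLeftGoldie S := by
  refine ⟨fun h => hS.isLeftGoldie_of_hasFiniteUDim h (hS.hasFiniteUDim_of_ring hR htf h.1),
    fun h => ?_⟩
  refine IsLeftNonsingular.isLeftGoldie (hS.isLeftNonsingular hR htf ?_)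
    ((hS.hasFiniteUDim_iff hR htf).2 h.1)
  exact h.hasElementACC.isLeftNonsingular (hS.semiprime hR htf)

/-- The left annihilator of an invariant element is an invariant left ideal. It has no nonzero fixed
elements, so it vanishes. -/
theorem isRegular_map (hG : IsLeftGoldie R) {c : S} (hc : IsRegular c) : IsRegular (ι c) := by
  refine isRegular_of_forall_mul_eq_zero hG.1 (hG.hasElementACC.isLeftNonsingular hR)
    fun x hx => ?_
  have : (AddMonoidHom.mulRight (ι c)).ker = ⊥ := by
    refine hS.eq_bot_of_comap_eq_zero hR htf (isLeftIdeal_ker_mulRight _) (fun g y hy => ?_)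
      fun s hs => ?_
    · change α g y * ι c = 0
      rw [← hS.apply_map g c, ← map_mul, show y * ι c = 0 from hy, map_zero]
    · refine hc.right (hS.injective ?_)
      change ι (s * c) = ι (0 * c)
      rw [zero_mul, map_mul, map_zero]
      exact hs
  exact (AddSubgroup.mem_bot).1 (this ▸ (show x ∈ (AddMonoidHom.mulRight (ι c)).ker from hx))

/-- `R * c` is essential, so its finitely many conjugates intersect in an essential invariant left
ideal. The fixed elements of that ideal form an essential left ideal of `S`, where Goldie's theorem
finds `d`. -/
theorem exists_isRegular_map_eq_mul (hG : IsLeftGoldie R) {c : R} (hc : IsRegular c) :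
    ∃ d : S, IsRegular d ∧ ∃ t, ι d = t * c := by
  have hess : IsEssential IsLeftIdeal (AddMonoidHom.mulRight c).range :=
    isEssential_range_mulRight hG.1 fun x hx => hc.right (by simpa using hx)
  have hP := isLeftIdeal_range_mulRight c
  have hE : IsEssential IsLeftIdeal (invariantCore α (AddMonoidHom.mulRight c).range) := by
    refine (IsEssential.iInf isSumClosed_isLeftIdeal (fun g => hess.comap_apply (α := α) g) (fun g => hP.comap_apply g)
      Finset.univ).mono fun y hy g => ?_
    exact (Finset.inf_le (f := fun g => (AddMonoidHom.mulRight c).range.comap (α g : R →+ R))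
      (Finset.mem_univ g)) hy
  have hSG := (hS.isLeftGoldie_iff hR htf).1 hG
  obtain ⟨d, hd, hreg⟩ := exists_isRegular_mem (hS.semiprime hR htf) hSG.1 hSG.hasElementACC
    (hP.invariantCore.comap_map ι) (hS.isEssential_comap hR htf hP.invariantCore
      (fun g x => apply_mem_invariantCore _ g) hE)
  obtain ⟨t, ht⟩ := invariantCore_le _ hd
  exact ⟨d, hreg, t, ht.symm⟩

end IsFixedRing
end FixedRing

/-! ### Quotient rings and the extended action -/

section QuotientRings

variable {R S : Type*} [NonUnitalRing R] [NonUnitalRing S] {Γ : Type*} [Group Γ]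
  {α : Γ →* RingAut R} {ι : S →ₙ+* R} {Q : Type*} [Ring Q] {f : R →ₙ+* Q}

theorem map_mem_regularElements (e : RingAut R) {c : R} (hc : c ∈ regularElements R) :
    e c ∈ regularElements R := by
  refine ⟨fun x y h => ?_, fun x y h => ?_⟩
  · refine e.symm.injective (hc.left (e.injective ?_))
    simpa using h
  · refine e.symm.injective (hc.right (e.injective ?_))
    simpa using h

/-- A group action extends uniquely to the classical left quotient ring. -/
theorem IsLeftQuotientRing.existsUnique_action (hf : IsLeftQuotientRing f) (α : Γ →* RingAut R) :
    ∃! ρ : Γ →* RingAut Q, ∀ g r, ρ g (f r) = f (α g r) := by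
  have hlift : ∀ g, ∃ Φ : Q →+* Q, ∀ r, Φ (f r) = f (α g r) := fun g =>
    IsLeftFractionRing.exists_lift hf (fun hs ht => IsRegular.mul hs ht)
      { toFun := fun r => f (α g r)
        map_mul' := fun r s => by rw [map_mul, map_mul]
        map_zero' := by rw [map_zero, map_zero]
        map_add' := fun r s => by rw [map_add, map_add] }
      fun s hs => hf.isUnit_map _ (map_mem_regularElements _ hs)
  choose Φ hΦ using hlift
  have hone : Φ 1 = RingHom.id Q := hf.ringHom_ext fun r => by simp [hΦ]
  have hmul : ∀ g h, Φ (g * h) = (Φ g).comp (Φ h) := fun g h =>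
    hf.ringHom_ext fun r => by simp [hΦ, map_mul]
  have hinv : ∀ g, (Φ g).comp (Φ g⁻¹) = RingHom.id Q := fun g => by
    rw [← hmul, mul_inv_cancel, hone]
  have hinv' : ∀ g, (Φ g⁻¹).comp (Φ g) = RingHom.id Q := fun g => by
    rw [← hmul, inv_mul_cancel, hone]
  refine ⟨{ toFun := fun g => RingEquiv.ofRingHom (Φ g) (Φ g⁻¹) (hinv g) (hinv' g)
            map_one' := ?_
            map_mul' := fun g h => ?_ }, fun g r => hΦ g r, fun ρ hρ => ?_⟩
  · ext q
    exact DFunLike.congr_fun hone q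
  · ext q
    exact DFunLike.congr_fun (hmul g h) q
  · ext g q
    have : (ρ g : Q →+* Q) = Φ g := hf.ringHom_ext fun r => (hρ g r).trans (hΦ g r).symm
    exact DFunLike.congr_fun this q

/-- The ring of invariants of the quotient ring is the quotient ring of the ring of invariants. -/
theorem IsFixedRing.isLeftQuotientRing_fixed (hS : IsFixedRing α ι)
    (hf : IsLeftFractionRing (ι '' regularElements S) f) (hinj : Function.Injective f)
    {ρ : Γ →* RingAut Q} (hρ : ∀ g r, ρ g (f r) = f (α g r)) {K : Type*} [Ring K] {j : K →+* Q}
    (hj : Function.Injective j) (hjρ : ∀ g k, ρ g (j k) = j k)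
    (hjK : ∀ q, (∀ g, ρ g q = q) → ∃ k, j k = q) {f₀ : S →ₙ+* K}
    (hf₀ : ∀ s, j (f₀ s) = f (ι s)) : IsLeftQuotientRing f₀ := by
  have hf₀inj : Function.Injective f₀ := fun s t h =>
    hS.injective (hinj (by rw [← hf₀, h, hf₀]))
  constructor
  · intro s hs
    obtain ⟨x, hx⟩ := hf.isUnit_map _ ⟨s, hs, rfl⟩
    -- The inverse of a fixed unit is fixed, so it already lies in the image of `K`.
    obtain ⟨k, hk⟩ := hjK ↑x⁻¹ fun g => by
      refine x.isUnit.mul_left_cancel ?_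
      rw [Units.mul_inv]
      have h1 : ρ g x = x := by rw [hx, hρ, hS.apply_map]
      conv_lhs => rw [← h1]
      rw [← map_mul, Units.mul_inv, map_one]
    refine ⟨⟨f₀ s, k, hj ?_, hj ?_⟩, rfl⟩
    · rw [map_mul, hf₀, hk, ← hx, Units.mul_inv, map_one]
    · rw [map_mul, hf₀, hk, ← hx, Units.inv_mul, map_one]
  · intro k
    obtain ⟨_, ⟨s, hs, rfl⟩, r, hr⟩ := hf.exists_fraction (j k)
    obtain ⟨t, rfl⟩ := hS.exists_map_eq r fun g => hinj (by
      rw [← hρ, ← hr, map_mul, hρ, hS.apply_map, hjρ])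
    exact ⟨s, hs, t, hj (by rw [map_mul, hf₀, hf₀, hr])⟩
  · intro s
    constructor
    · intro h
      obtain ⟨_, ⟨t, ht, -⟩, -⟩ := hf.exists_fraction 0
      exact ⟨t, ht, by rw [(map_eq_zero_iff f₀ hf₀inj).1 h, mul_zero]⟩
    · rintro ⟨t, ht, h⟩
      rw [ht.left (show t * s = t * 0 by rw [h, mul_zero]), map_zero]

variable [Fintype Γ]

theorem IsFixedRing.isLeftFractionRing_image (hS : IsFixedRing α ι)
    (hR : ∀ a : R, (∀ r, a * r * a = 0) → a = 0)
    (htf : ∀ x : R, Fintype.card Γ • x = 0 → x = 0) (hG : IsLeftGoldie R)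
    (hf : IsLeftQuotientRing f) : IsLeftFractionRing (ι '' regularElements S) f := by
  constructor
  · rintro _ ⟨c, hc, rfl⟩
    exact hf.isUnit_map _ (hS.isRegular_map hR htf hG hc)
  · intro q
    obtain ⟨c, hc, r, hr⟩ := hf.exists_fraction q
    obtain ⟨d, hd, t, ht⟩ := hS.exists_isRegular_map_eq_mul hR htf hG hc
    exact ⟨_, ⟨d, hd, rfl⟩, t * r, by rw [ht, map_mul, mul_assoc, hr, map_mul]⟩
  · intro r
    constructor
    · intro h
      obtain ⟨c, hc, -⟩ := hf.exists_fraction 0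
      obtain ⟨d, hd, -⟩ := hS.exists_isRegular_map_eq_mul hR htf hG hc
      refine ⟨_, ⟨d, hd, rfl⟩, ?_⟩
      rw [(map_eq_zero_iff f (hf.injective subset_rfl)).1 h, mul_zero]
    · rintro ⟨_, ⟨d, hd, rfl⟩, h⟩
      exact (hf.map_eq_zero_iff r).2 ⟨_, hS.isRegular_map hR htf hG hd, h⟩

theorem IsLeftGoldie.exists_isLeftQuotientRing {A : Type u} [NonUnitalRing A]
    (hA : ∀ a : A, (∀ r, a * r * a = 0) → a = 0) (hG : IsLeftGoldie A) :
    ∃ (Q : Type u) (_ : Ring Q) (f : A →ₙ+* Q), IsLeftQuotientRing f := by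
  refine InvRing.exists_isLeftQuotientRing
    (fun r c hc => exists_isRegular_mul_eq hA hG.1 hG.hasElementACC r hc) ?_
  obtain ⟨c, -, hc⟩ := exists_isRegular_mem hA hG.1 hG.hasElementACC (E := ⊤)
    (fun _ _ _ => AddSubgroup.mem_top _) (fun X _ hd => by simpa using hd)
  exact ⟨c, hc⟩

end QuotientRings

/-! ### Absence of `|G|`-torsion -/

section Torsion

variable {R : Type*} [NonUnitalRing R]

theorem smul_eq_zero_of_forall_prime {M : Type*} [AddCommGroup M] {n : ℕ} (hn : n ≠ 0)
    (h : ∀ p, p.Prime → p ∣ n → ∀ x : M, p • x = 0 → x = 0) {x : M} (hx : n • x = 0) : x = 0 := by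
  induction n using induction_on_primes generalizing x with
  | zero => exact absurd rfl hn
  | one => simpa using hx
  | prime_mul p a hp ih =>
    refine ih (right_ne_zero_of_mul hn) (fun q hq hqa => h q hq (hqa.mul_left p))
      (h p hp (dvd_mul_right p a) _ ?_)
    rwa [smul_smul]

theorem sup_eq_top_of_normalPComplement {H : Type*} [Group H] [Finite H] {p : ℕ}
    [Fact p.Prime] {N : Subgroup H} {s : ℕ} (hN : ¬ p ∣ Nat.card N)
    (hs : Nat.card H = p ^ s * Nat.card N) (P : Sylow p H) : N ⊔ P = ⊤ := by
  have hp : p.Prime := Fact.out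
  have hP : Nat.card P = p ^ s := by
    rw [P.card_eq_multiplicity, hs, Nat.factorization_mul (pow_ne_zero _ hp.ne_zero)
      Nat.card_pos.ne', hp.factorization_pow]
    simp [Nat.factorization_eq_zero_of_not_dvd hN]
  refine (Subgroup.isComplement'_of_coprime ?_ ?_).sup_eq_top
  · rw [hP, hs, mul_comm]
  · rw [hP]
    exact Nat.Coprime.pow_right _ ((hp.coprime_iff_not_dvd.2 hN).symm)

/-- The additive subgroup of `p`-primary elements. -/
def primaryPart (R : Type*) [NonUnitalRing R] (p : ℕ) : AddSubgroup R where
  carrier := {x | ∃ i : ℕ, p ^ i • x = 0}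
  zero_mem' := ⟨0, smul_zero _⟩
  add_mem' := by
    rintro a b ⟨i, hi⟩ ⟨j, hj⟩
    refine ⟨i + j, ?_⟩
    rw [smul_add, pow_add, mul_comm, mul_smul, hi, smul_zero, mul_comm, mul_smul, hj, smul_zero,
      add_zero]
  neg_mem' := by
    rintro a ⟨i, hi⟩
    exact ⟨i, by rw [smul_neg, hi, neg_zero]⟩

/-- A nonzero `p`-primary part contains a nonzero element of order `p` that is invariant under a
given finite group of automorphisms of order prime to `p`. -/
theorem exists_fixed_of_primaryPart_ne_bot (hR : ∀ a : R, (∀ r, a * r * a = 0) → a = 0) {p : ℕ}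
    (hp : p.Prime) {Γ : Type*} [Group Γ] [Finite Γ] (hΓ : ¬ p ∣ Nat.card Γ) (α : Γ →* RingAut R)
    (hT : primaryPart R p ≠ ⊥) : ∃ z : R, z ≠ 0 ∧ p • z = 0 ∧ ∀ g, α g z = z := by
  classical
  have := Fintype.ofFinite Γ
  have hTG : ∀ g, ∀ x ∈ primaryPart R p, α g x ∈ primaryPart R p := by
    rintro g x ⟨i, hi⟩
    exact ⟨i, by rw [← map_nsmul, hi, map_zero]⟩
  -- Since `|Γ|` is prime to `p`, the primary part has no `|Γ|`-torsion, so Bergman–Isaacs forbids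
  -- all its traces from vanishing.
  obtain ⟨x, hx, hx0⟩ : ∃ x ∈ primaryPart R p, trace α x ≠ 0 := by
    by_contra! h
    refine hT (eq_bot_of_mul_trace_eq_zero (α := α) hR ?_ hTG ?_ fun x _ y hy => ?_)
    · rintro r x ⟨i, hi⟩
      exact ⟨i, by rw [← mul_smul_comm, hi, mul_zero]⟩
    · rintro x ⟨i, hi⟩ hx
      rw [← Nat.card_eq_fintype_card] at hx
      have h1 := Nat.dvd_gcd (addOrderOf_dvd_of_nsmul_eq_zero hi)
        (addOrderOf_dvd_of_nsmul_eq_zero hx)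
      rw [Nat.Coprime.gcd_eq_one (Nat.Coprime.pow_left _ (hp.coprime_iff_not_dvd.2 hΓ)),
        Nat.dvd_one, AddMonoid.addOrderOf_eq_one_iff] at h1
      exact h1
    · rw [h y hy, mul_zero]
  have hex : ∃ i : ℕ, p ^ i • trace α x = 0 := trace_mem hTG hx
  obtain ⟨k, hk⟩ : ∃ k, Nat.find hex = k + 1 :=
    Nat.exists_eq_succ_of_ne_zero fun h0 => hx0 (by simpa [h0] using Nat.find_spec hex)
  refine ⟨p ^ k • trace α x, Nat.find_min hex (by omega), ?_, fun g => ?_⟩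
  · rw [smul_smul, ← pow_succ', ← hk]
    exact Nat.find_spec hex
  · rw [map_nsmul, apply_trace]

/-- The orbit of `z` spans a finite group `B` killed by `p`, on which `N` acts trivially because it
is normal. A Sylow `p`-subgroup fixes a nonzero point of `B`, since the number of its fixed points
is divisible by `p` and `0` is one of them. -/
theorem exists_fixed_of_normalPComplement {p : ℕ} [hp : Fact p.Prime] {M : Type*} [AddCommGroup M]
    {H : Type*} [Group H] [Finite H] [DistribMulAction H M] {N : Subgroup H} [N.Normal] {s : ℕ}
    (hN : ¬ p ∣ Nat.card N) (hs : Nat.card H = p ^ s * Nat.card N) {z : M} (hz0 : z ≠ 0)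
    (hpz : p • z = 0) (hz : ∀ g ∈ N, g • z = z) : ∃ b : M, b ≠ 0 ∧ p • b = 0 ∧ ∀ g : H, g • b = b := by
  let B : AddSubgroup M := AddSubgroup.closure (Set.range fun g : H => g • z)
  have hBp : ∀ b ∈ B, p • b = 0 := by
    intro b hb
    have : B ≤ (nsmulAddMonoidHom (α := M) p).ker := by
      refine (AddSubgroup.closure_le _).2 ?_
      rintro _ ⟨g, rfl⟩
      change p • g • z = 0
      rw [smul_comm, hpz, smul_zero]
    exact this hb
  have hBN : ∀ b ∈ B, ∀ g ∈ N, g • b = b := by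
    intro b hb g hg
    induction hb using AddSubgroup.closure_induction with
    | mem b hb =>
      obtain ⟨h, rfl⟩ := hb
      have := hz _ (Subgroup.Normal.conj_mem ‹_› g hg h⁻¹)
      dsimp only
      rw [inv_inv, mul_smul, mul_smul, inv_smul_eq_iff] at this
      exact this
    | zero => exact smul_zero g
    | add x y _ _ hx hy => rw [smul_add, hx, hy]
    | neg x _ hx => rw [smul_neg, hx]
  have hBH : ∀ b ∈ B, ∀ g : H, g • b ∈ B := by
    intro b hb g
    have : B ≤ B.comap (DistribSMul.toAddMonoidHom M g) := by
      refine (AddSubgroup.closure_le _).2 ?_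
      rintro _ ⟨h, rfl⟩
      exact AddSubgroup.subset_closure ⟨g * h, mul_smul g h z⟩
    exact this hb
  obtain ⟨P⟩ : Nonempty (Sylow p H) := inferInstance
  let C : SubMulAction P M := { carrier := B, smul_mem' := fun g b hb => hBH b hb g }
  have hBfin : Finite B := by
    have : AddGroup.FG B := (AddGroup.fg_iff_addSubgroup_fg B).2
      ⟨(Set.finite_range fun g : H => g • z).toFinset, by simp [B]⟩
    exact AddCommGroup.finite_of_fg_isAddTorsion B fun b => isOfFinAddOrder_iff_nsmul_eq_zero.2
      ⟨p, hp.out.pos, Subtype.ext (hBp b b.2)⟩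
  have hzB : z ∈ B := AddSubgroup.subset_closure ⟨1, one_smul H z⟩
  have hcard : p ∣ Nat.card B := by
    have : addOrderOf (⟨z, hzB⟩ : B) = p :=
      addOrderOf_eq_prime (Subtype.ext hpz) fun h => hz0 (congrArg Subtype.val h)
    rw [← this]
    exact addOrderOf_dvd_natCard _
  have : Finite C := hBfin
  obtain ⟨b, hb, hb0⟩ := P.isPGroup'.exists_fixed_point_of_prime_dvd_card_of_fixed_point C hcard
    (a := ⟨0, B.zero_mem⟩) fun g => Subtype.ext (smul_zero (g : H))
  refine ⟨b, fun h => hb0 (Subtype.ext h.symm), hBp b b.2, fun g => ?_⟩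
  have htop : (⊤ : Subgroup H) ≤ MulAction.stabilizer H (b : M) := by
    rw [← sup_eq_top_of_normalPComplement hN hs P]
    refine sup_le (fun g hg => hBN b b.2 g hg) fun g hg => ?_
    exact congrArg Subtype.val (hb ⟨g, hg⟩)
  exact htop (Subgroup.mem_top g)

/-- Under the hypotheses on bad primes, `R` has no `|G|`-torsion. -/
theorem smul_card_eq_zero (hR : ∀ a : R, (∀ r, a * r * a = 0) → a = 0)
    (G : Subgroup (RingAut R)) [Finite G]
    (hG : ∀ p ∈ badPrimes G,
      HasNormalPComplement G p ∧ IsTorsionFreeRing (invariants G) (Nat.card G))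
    (x : R) (hx : Nat.card G • x = 0) : x = 0 := by
  refine smul_eq_zero_of_forall_prime Nat.card_pos.ne' (fun p hp hpG y hy => ?_) hx
  by_contra hy0
  have hbad : p ∈ badPrimes G := ⟨hp, hpG, fun h => hy0 (by
    have : y ∈ torsionSet R p := ⟨1, le_rfl, by rwa [pow_one]⟩
    rwa [h] at this)⟩
  obtain ⟨⟨N, hNn, hN, s, hs⟩, htf⟩ := hG p hbad
  have := Fact.mk hp
  have hT : primaryPart R p ≠ ⊥ := fun h =>
    hy0 ((AddSubgroup.mem_bot).1 (h ▸ ⟨1, by rwa [pow_one]⟩))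
  obtain ⟨z, hz0, hpz, hz⟩ := exists_fixed_of_primaryPart_ne_bot hR hp hN
    (G.subtype.comp N.subtype) hT
  let _ : DistribMulAction G R :=
    { smul := fun g r => (g : RingAut R) r
      one_smul := fun _ => rfl
      mul_smul := fun _ _ _ => rfl
      smul_zero := fun g => map_zero (g : RingAut R)
      smul_add := fun g => map_add (g : RingAut R) }
  obtain ⟨b, hb0, hpb, hb⟩ := exists_fixed_of_normalPComplement (H := G) (M := R) hN hs hz0 hpz
    fun g hg => hz ⟨g, hg⟩
  have hmem : (⟨b, fun g hg => hb ⟨g, hg⟩⟩ : invariants G) ∈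
      torsionSet (invariants G) (Nat.card G) := by
    refine ⟨1, le_rfl, Subtype.ext ?_⟩
    obtain ⟨k, hk⟩ := hpG
    change Nat.card G ^ 1 • b = 0
    rw [pow_one, hk, mul_comm, mul_smul, hpb, smul_zero]
  rw [htf] at hmem
  exact hb0 (congrArg Subtype.val hmem)

end Torsion

open MulOpposite

/-! ### Passage to the opposite ring -/

section Opposite

theorem isDirectFamily_map_iff {R R' : Type*} [NonUnitalRing R] [NonUnitalRing R']
    {P : AddSubgroup R → Prop} {P' : AddSubgroup R' → Prop} (e : AddSubgroup R ≃o AddSubgroup R')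
    (he : ∀ I, P' (e I) ↔ P I) {κ : Type*} (I : κ → AddSubgroup R) :
    IsDirectFamily P' (fun i => e (I i)) ↔ IsDirectFamily P I := by
  unfold IsDirectFamily
  refine and_congr (forall_congr' fun i => and_congr (he _) ?_) (iSupIndep_map_orderIso_iff e)
  rw [ne_eq, ne_eq, map_eq_bot_iff]

theorem exists_isDirectFamily_iff {R R' : Type*} [NonUnitalRing R] [NonUnitalRing R']
    {P : AddSubgroup R → Prop} {P' : AddSubgroup R' → Prop} (e : AddSubgroup R ≃o AddSubgroup R')
    (he : ∀ I, P' (e I) ↔ P I) (κ : Type*) :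
    (∃ I : κ → AddSubgroup R', IsDirectFamily P' I) ↔
      ∃ I : κ → AddSubgroup R, IsDirectFamily P I := by
  refine ⟨fun ⟨I, hI⟩ => ⟨fun i => e.symm (I i), ?_⟩,
    fun ⟨I, hI⟩ => ⟨_, (isDirectFamily_map_iff e he I).2 hI⟩⟩
  rw [← isDirectFamily_map_iff e he]
  simpa using hI

variable {R S : Type*} [NonUnitalRing R] [NonUnitalRing S]

theorem isLeftIdeal_op_iff (I : AddSubgroup R) :
    IsLeftIdeal ((opAddEquiv : R ≃+ Rᵐᵒᵖ).mapAddSubgroup I) ↔ IsRightIdeal I := by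
  constructor
  · intro h r x hx
    obtain ⟨y, hy, hyx⟩ := h (op r) (op x) ⟨x, hx, rfl⟩
    have : y = x * r := op_injective hyx
    rwa [← this]
  · rintro h r _ ⟨x, hx, rfl⟩
    exact ⟨x * r.unop, h _ x hx, rfl⟩

theorem hasFiniteLeftUDim_op : HasFiniteLeftUDim Rᵐᵒᵖ ↔ HasFiniteRightUDim R :=
  not_congr (exists_isDirectFamily_iff _ isLeftIdeal_op_iff ℕ)

theorem leftUDim_op : leftUDim Rᵐᵒᵖ = rightUDim R := by
  unfold leftUDim rightUDim uDim
  simp only [Set.mem_ofPred_eq, exists_isDirectFamily_iff _ (isLeftIdeal_op_iff (R := R))]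

theorem leftAnn_preimage_unop (X : Set R) :
    leftAnn (unop ⁻¹' X) = (unop ⁻¹' rightAnn X : Set Rᵐᵒᵖ) := by
  ext r
  exact ⟨fun h x hx => op_injective (h (op x) hx), fun h x hx => unop_injective (h x.unop hx)⟩

theorem preimage_unop_injective {A : Type*} :
    Function.Injective fun X : Set A => (unop ⁻¹' X : Set Aᵐᵒᵖ) :=
  unop_surjective.preimage_injective

theorem isLeftGoldie_op : IsLeftGoldie Rᵐᵒᵖ ↔ IsRightGoldie R := by
  refine and_congr hasFiniteLeftUDim_op ⟨fun h X hX hmono => ?_, fun h X hX hmono => ?_⟩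
  · obtain ⟨N, hN⟩ := h (fun n => unop ⁻¹' X n) (fun n => (hX n).preimage unop_surjective)
      fun m n hmn => by
        simp only [leftAnn_preimage_unop]
        exact Set.preimage_mono (hmono hmn)
    exact ⟨N, fun n hn => preimage_unop_injective (by
      simpa only [leftAnn_preimage_unop] using hN n hn)⟩
  · have key : ∀ n, leftAnn (X n) = unop ⁻¹' rightAnn (op ⁻¹' X n) := fun n =>
      leftAnn_preimage_unop (op ⁻¹' X n)
    simp only [key] at hmono ⊢
    obtain ⟨N, hN⟩ := h (fun n => op ⁻¹' X n) (fun n => (hX n).preimage op_surjective)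
      fun m n hmn r hr => hmono hmn (show op r ∈ unop ⁻¹' _ from hr)
    exact ⟨N, fun n hn => by rw [hN n hn]⟩

theorem regularElements_op : regularElements Rᵐᵒᵖ = unop ⁻¹' regularElements R := by
  ext c
  constructor
  · exact fun h => ⟨fun x y hxy => op_injective (h.right (unop_injective hxy)),
      fun x y hxy => op_injective (h.left (unop_injective hxy))⟩
  · exact fun h => ⟨fun x y hxy => unop_injective (h.right (op_injective hxy)),
      fun x y hxy => unop_injective (h.left (op_injective hxy))⟩

theorem image_op_regularElements (ι : S →ₙ+* R) :
    NonUnitalRingHom.op ι '' regularElements Sᵐᵒᵖ = unop ⁻¹' (ι '' regularElements S) := by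
  rw [regularElements_op]
  ext x
  constructor
  · rintro ⟨s, hs, rfl⟩
    exact ⟨s.unop, hs, rfl⟩
  · rintro ⟨s, hs, hsx⟩
    exact ⟨op s, hs, unop_injective hsx⟩

theorem isLeftFractionRing_op {Q : Type*} [Ring Q] {X : Set R} {f : R →ₙ+* Q} :
    IsLeftFractionRing (unop ⁻¹' X) (NonUnitalRingHom.op f) ↔ IsRightFractionRing X f := by
  constructor
  · intro h
    refine ⟨fun s hs => isUnit_op.1 (h.isUnit_map (op s) hs), fun q => ?_, fun r => ?_⟩
    · obtain ⟨s, hs, r, hr⟩ := h.exists_fraction (op q)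
      exact ⟨s.unop, hs, r.unop, op_injective hr⟩
    · refine (op_eq_zero_iff (f r)).symm.trans ((h.map_eq_zero_iff (op r)).trans ?_)
      exact ⟨fun ⟨s, hs, h⟩ => ⟨s.unop, hs, op_injective h⟩,
        fun ⟨s, hs, h⟩ => ⟨op s, hs, unop_injective h⟩⟩
  · intro h
    refine ⟨fun s hs => isUnit_op.2 (h.isUnit_map s.unop hs), fun q => ?_, fun r => ?_⟩
    · obtain ⟨s, hs, r, hr⟩ := h.exists_fraction q.unop
      exact ⟨op s, hs, op r, unop_injective hr⟩
    · refine (op_eq_zero_iff (f r.unop)).trans ((h.map_eq_zero_iff r.unop).trans ?_)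
      exact ⟨fun ⟨s, hs, h⟩ => ⟨op s, hs, unop_injective h⟩,
        fun ⟨s, hs, h⟩ => ⟨s.unop, hs, op_injective h⟩⟩

theorem isLeftQuotientRing_op {Q : Type*} [Ring Q] {f : R →ₙ+* Q} :
    IsLeftQuotientRing (NonUnitalRingHom.op f) ↔ IsRightQuotientRing f := by
  unfold IsLeftQuotientRing IsRightQuotientRing
  rw [regularElements_op, isLeftFractionRing_op]

/-- An automorphism of a ring is an automorphism of the opposite ring. -/
def opAut (R : Type*) [Mul R] [Add R] : RingAut R ≃* RingAut Rᵐᵒᵖ where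
  toEquiv := RingEquiv.op
  map_mul' _ _ := rfl

variable {Γ : Type*} [Group Γ] {α : Γ →* RingAut R} {ι : S →ₙ+* R}

theorem IsFixedRing.op (hS : IsFixedRing α ι) :
    IsFixedRing ((opAut R).toMonoidHom.comp α) (NonUnitalRingHom.op ι) where
  injective _ _ h := unop_injective (hS.injective (op_injective h))
  apply_map g s := unop_injective (hS.apply_map g s.unop)
  exists_map_eq r hr := by
    obtain ⟨s, hs⟩ := hS.exists_map_eq r.unop fun g => op_injective (hr g)
    exact ⟨MulOpposite.op s, unop_injective hs⟩

/-- A group action extends uniquely to the classical right quotient ring. -/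
theorem IsRightQuotientRing.existsUnique_action {Q : Type*} [Ring Q] {f : R →ₙ+* Q}
    (hf : IsRightQuotientRing f) (α : Γ →* RingAut R) :
    ∃! ρ : Γ →* RingAut Q, ∀ g r, ρ g (f r) = f (α g r) := by
  obtain ⟨ρ, hρ, huniq⟩ := (isLeftQuotientRing_op.2 hf).existsUnique_action
    ((opAut R).toMonoidHom.comp α)
  refine ⟨(opAut Q).symm.toMonoidHom.comp ρ, fun g r => op_injective (hρ g (MulOpposite.op r)),
    fun ρ' hρ' => ?_⟩
  have := huniq ((opAut Q).toMonoidHom.comp ρ') fun g r => unop_injective (hρ' g r.unop)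
  ext g q
  rw [← this]
  rfl

end Opposite

/-! ### The ring of invariants as a fixed ring -/

section Invariants

variable {R : Type*} [NonUnitalRing R] (G : Subgroup (RingAut R))

theorem isFixedRing_invariants :
    IsFixedRing G.subtype (NonUnitalSubringClass.subtype (invariants G)) where
  injective := Subtype.val_injective
  apply_map g s := s.2 g g.2
  exists_map_eq r hr := ⟨⟨r, fun g hg => hr ⟨g, hg⟩⟩, rfl⟩

end Invariants

end InvRing

/-! ### The main theorem -/

theorem corollary1p6 {R : Type u} [NonUnitalRing R] (hR : IsSemiprimeRing R)
    (G : Subgroup (RingAut R)) [Finite G]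
    (hG : ∀ p ∈ badPrimes G,
      HasNormalPComplement G p ∧ IsTorsionFreeRing (invariants G) (Nat.card G)) :
    -- the left Goldie property and left quotient rings
    ((IsLeftGoldie R ↔ IsLeftGoldie (invariants G)) ∧
      (IsLeftGoldie R →
        regularInvariants G ⊆ regularElements R ∧
        (∃ (Q : Type u) (_ : Ring Q) (f : R →ₙ+* Q), IsLeftQuotientRing f) ∧
        ∀ (Q : Type v) [Ring Q] (f : R →ₙ+* Q), IsLeftQuotientRing f →
          IsLeftFractionRing (regularInvariants G) f ∧
          (∃! ρ : G →* RingAut Q, ExtendsAction f ρ) ∧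
          ∀ (ρ : G →* RingAut Q) (hρ : ExtendsAction f ρ),
            IsLeftQuotientRing (fixedMap f ρ hρ))) ∧
    -- the right Goldie property and right quotient rings
    ((IsRightGoldie R ↔ IsRightGoldie (invariants G)) ∧
      (IsRightGoldie R →
        regularInvariants G ⊆ regularElements R ∧
        (∃ (Q : Type u) (_ : Ring Q) (f : R →ₙ+* Q), IsRightQuotientRing f) ∧
        ∀ (Q : Type v) [Ring Q] (f : R →ₙ+* Q), IsRightQuotientRing f →
          IsRightFractionRing (regularInvariants G) f ∧
          (∃! ρ : G →* RingAut Q, ExtendsAction f ρ) ∧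
          ∀ (ρ : G →* RingAut Q) (hρ : ExtendsAction f ρ),
            IsRightQuotientRing (fixedMap f ρ hρ))) ∧
    -- left uniform dimensions
    ((HasFiniteLeftUDim R ↔ HasFiniteLeftUDim (invariants G)) ∧
      (HasFiniteLeftUDim R →
        leftUDim R < ⊤ ∧
        leftUDim (invariants G) ≤ leftUDim R ∧
        leftUDim R ≤ (Nat.card G : ℕ∞) * leftUDim (invariants G))) ∧
    -- right uniform dimensions
    ((HasFiniteRightUDim R ↔ HasFiniteRightUDim (invariants G)) ∧
      (HasFiniteRightUDim R →
        rightUDim R < ⊤ ∧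
        rightUDim (invariants G) ≤ rightUDim R ∧
        rightUDim R ≤ (Nat.card G : ℕ∞) * rightUDim (invariants G))) := by
  classical
  have := Fintype.ofFinite G
  have hs : ∀ a : R, (∀ r, a * r * a = 0) → a = 0 := fun a => hR.eq_zero_of_mul_mul
  have htf : ∀ x : R, Fintype.card G • x = 0 → x = 0 := fun x hx =>
    smul_card_eq_zero hs G hG x (by rwa [Nat.card_eq_fintype_card])
  have hS := isFixedRing_invariants G
  have hs' : ∀ a : Rᵐᵒᵖ, (∀ r, a * r * a = 0) → a = 0 := fun a ha =>
    MulOpposite.unop_injective (hs a.unop fun r => by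
      rw [mul_assoc]
      exact MulOpposite.op_injective (ha (MulOpposite.op r)))
  have htf' : ∀ x : Rᵐᵒᵖ, Fintype.card G • x = 0 → x = 0 := fun x hx =>
    MulOpposite.unop_injective (htf x.unop (MulOpposite.op_injective hx))
  have hS' := hS.op
  have hreg : regularInvariants G =
    NonUnitalSubringClass.subtype (invariants G) '' regularElements (invariants G) := rfl
  refine ⟨⟨hS.isLeftGoldie_iff hs htf, fun hL => ⟨?_, hL.exists_isLeftQuotientRing hs, ?_⟩⟩,
    ⟨?_, fun hr => ?_⟩,
    ⟨hS.hasFiniteUDim_iff hs htf, fun h => ⟨h.uDim_lt_top isSumClosed_isLeftIdeal,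
      hS.uDim_le hs htf, ?_⟩⟩, ⟨?_, fun h => ?_⟩⟩
  · rintro _ ⟨c, hc, rfl⟩
    exact hS.isRegular_map hs htf hL hc
  · intro Q _ f hf
    have hfr := hS.isLeftFractionRing_image hs htf hL hf
    refine ⟨hfr, hf.existsUnique_action G.subtype, fun ρ hρ => ?_⟩
    exact hS.isLeftQuotientRing_fixed hfr (hf.injective subset_rfl) hρ
      (j := (fixedRing ρ).subtype) Subtype.val_injective (fun g k => k.2 g)
      (fun q hq => ⟨⟨q, hq⟩, rfl⟩) fun s => rfl
  · rw [← isLeftGoldie_op, ← isLeftGoldie_op]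
    exact hS'.isLeftGoldie_iff hs' htf'
  · have hL := isLeftGoldie_op.2 hr
    refine ⟨?_, ?_, ?_⟩
    · rintro _ ⟨c, hc, rfl⟩
      have hc' : IsRegular (MulOpposite.op c) := by
        change _ ∈ regularElements _
        rw [regularElements_op]
        exact hc
      have := hS'.isRegular_map hs' htf' hL hc'
      change _ ∈ regularElements _ at this
      rw [regularElements_op] at this
      exact this
    -- The opposite of a left quotient ring of `Rᵐᵒᵖ` is a right quotient ring of `R`.
    · obtain ⟨Q, _, f, hf⟩ := hL.exists_isLeftQuotientRing hs'
      refine ⟨Qᵐᵒᵖ, inferInstance,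
        { toFun := fun r => MulOpposite.op (f (MulOpposite.op r))
          map_mul' := fun r s => MulOpposite.unop_injective (map_mul f _ _)
          map_zero' := MulOpposite.unop_injective (map_zero f)
          map_add' := fun r s => MulOpposite.unop_injective (map_add f _ _) }, ?_⟩
      have hX := hf
      unfold IsLeftQuotientRing at hX
      rw [regularElements_op] at hX
      refine ⟨fun s hs => isUnit_op.2 (hX.isUnit_map (MulOpposite.op s) hs), fun q => ?_,
        fun r => ?_⟩
      · obtain ⟨s, hs, r, hr⟩ := hX.exists_fraction q.unop
        exact ⟨s.unop, hs, r.unop, MulOpposite.unop_injective hr⟩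
      · refine (MulOpposite.op_eq_zero_iff _).trans
          ((hX.map_eq_zero_iff (MulOpposite.op r)).trans ?_)
        exact ⟨fun ⟨s, hs, h⟩ => ⟨s.unop, hs, MulOpposite.op_injective h⟩,
          fun ⟨s, hs, h⟩ => ⟨MulOpposite.op s, hs, MulOpposite.unop_injective h⟩⟩
    · intro Q _ f hf
      have hf' := isLeftQuotientRing_op.2 hf
      have hfr := hS'.isLeftFractionRing_image hs' htf' hL hf'
      have hfr' := hfr
      rw [image_op_regularElements] at hfr'
      refine ⟨isLeftFractionRing_op.1 hfr', hf.existsUnique_action G.subtype, fun ρ hρ => ?_⟩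
      refine isLeftQuotientRing_op.1 ?_
      exact hS'.isLeftQuotientRing_fixed (ρ := (opAut Q).toMonoidHom.comp ρ) hfr
        (hf'.injective subset_rfl) (fun g r => MulOpposite.unop_injective (hρ g r.unop))
        (j := (fixedRing ρ).subtype.op) (fun x y h => MulOpposite.unop_injective
          (Subtype.val_injective (MulOpposite.op_injective h)))
        (fun g k => MulOpposite.unop_injective (k.unop.2 g))
        (fun q hq => ⟨MulOpposite.op ⟨q.unop, fun g => MulOpposite.op_injective (hq g)⟩, rfl⟩)
        fun s => rfl
  · rw [Nat.card_eq_fintype_card]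
    exact hS.uDim_ring_le hs htf ((hS.hasFiniteUDim_iff hs htf).1 h)
  · rw [← hasFiniteLeftUDim_op, ← hasFiniteLeftUDim_op]
    exact hS'.hasFiniteUDim_iff hs' htf'
  · have h' := hasFiniteLeftUDim_op.2 h
    rw [← leftUDim_op, ← leftUDim_op, Nat.card_eq_fintype_card]
    exact ⟨h'.uDim_lt_top isSumClosed_isLeftIdeal, hS'.uDim_le hs' htf',
      hS'.uDim_ring_le hs' htf' ((hS'.hasFiniteUDim_iff hs' htf').1 h')⟩
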